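/- Let $F_2=\langle a,b\rangle$ be the free group with free basis $a,b$, let $u,v\in F_2$ be any elements, and let $G=\langle a,b \mid uvu^{-1}v^{-1}\rangle$. Suppose that the word obtained from $uvu^{-1}v^{-1}$ by reducing and then cyclically reducing is not a cyclic conjugate (cyclic permutation) of $aba^{-1}b^{-1}$ or of $bab^{-1}a^{-1}$. Then $G$ is large or $G$ is residually useless. Here a finitely generated group $G$ is *large* if it has a finite index subgroup possessing a homomorphism onto a non-abelian free group, and *residually useless* if $G$ is non-abelian and its commutator subgroup $G'$ equals the intersection of all finite index subgroups of $G$. -/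

import Mathlib

/-- A finitely generated group is large if some finite index subgroup of it possesses a surjective
homomorphism onto a non-abelian free group. (A free group is non-abelian exactly when its basis
has at least two elements.) -/
def IsLargeGroup (G : Type*) [Group G] : Prop :=
  Group.FG G ∧ ∃ H : Subgroup G, H.FiniteIndex ∧
    ∃ ι : Type, Nontrivial ι ∧ ∃ f : H →* FreeGroup ι, Function.Surjective f

/-- A finitely generated group is residually useless if it is non-abelian and its commutator
subgroup is the intersection of all its finite index subgroups. -/
def IsResiduallyUseless (G : Type*) [Group G] : Prop :=
  Group.FG G ∧ (¬ ∀ x y : G, x * y = y * x) ∧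
    commutator G = ⨅ F ∈ {F : Subgroup G | F.FiniteIndex}, F

/-- The word obtained from an element of a free group by reducing and then cyclically reducing. -/
def cyclicReduction {α : Type*} [DecidableEq α] (w : FreeGroup α) : List (α × Bool) :=
  FreeGroup.reduceCyclically w.toWord

/-! The proof is a dichotomy on whether the images of `u` and `v` lie together in a proper finite
index subgroup `S` of `G`.

If they never do, they generate every finite quotient of `G`. They commute, so every finite quotient
is abelian and `G'` lies in every finite index subgroup (`commutator_le_of_finiteIndex`). Conversely
the abelianization of `G` is `ℤ²`, which is residually finite, so the intersection lies in `G'`. If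
`G` were abelian, `[a,b]` would be a consequence of `[u,v]`. Magnus rewriting and the Freiheitssatz
then force `[u,v]` to be conjugate to `[a,b]` or its inverse
(`isConj_commutator_of_mem_normalClosure`), and conjugate elements have cyclic reductions that are
rotations of each other. This is what the hypotheses exclude.

If such an `S` exists, `G` is large. Let `X = G/S`, with base point `x₀` fixed by `u` and `v`. For a
crossed homomorphism `D` into a module of functions on `X`, the condition `D([u,v]) = 0` is
automatic at `x₀`, so counting dimensions leaves more solutions than principal ones. With rational
coefficients this gives a nonzero map `S → ℤ` killing `u` and `v` (`exists_additive_cocycle`).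
Twisting by that map and counting again over Laurent polynomials gives a non-abelian image of `S` in
`ℤ ≀ ℤ` (`exists_twisted_cocycle`). Only finitely many relations of `ℤ ≀ ℤ` are needed to kill the
relator, and these already hold in `F₂ ≀ ℤ/N` for large `N`. A finite index subgroup of `G`
therefore maps to `F₂` with non-abelian image (`isLargeGroup_of_cocycles`). -/

namespace FreeGroup

/-! ### Subgroups on some of the generators, and conjugacy of cyclically reduced words -/

variable {α : Type*}

/-- The subgroup of a free group generated by the free generators in `S`. -/
def supported (S : Set α) : Subgroup (FreeGroup α) := Subgroup.closure (of '' S)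

theorem of_mem_supported {S : Set α} {x : α} (hx : x ∈ S) : of x ∈ supported S :=
  Subgroup.subset_closure ⟨x, hx, rfl⟩

theorem supported_mono {S T : Set α} (h : S ⊆ T) : supported S ≤ supported T :=
  Subgroup.closure_mono (Set.image_mono h)

theorem mk_mem_supported {S : Set α} {L : List (α × Bool)} (h : ∀ l ∈ L, l.1 ∈ S) :
    mk L ∈ supported S := by
  induction L with
  | nil => exact one_mem _
  | cons a L ih =>
    have : mk (a :: L) = mk [a] * mk L := by rw [mul_mk]; rfl
    rw [this]
    refine mul_mem ?_ (ih fun l hl => h l (List.mem_cons_of_mem _ hl))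
    have ha : of a.1 ∈ supported S := of_mem_supported (h a List.mem_cons_self)
    obtain ⟨y, b⟩ := a
    cases b
    · exact inv_mem ha
    · exact ha

theorem mem_supported_iff [DecidableEq α] {S : Set α} {w : FreeGroup α} :
    w ∈ supported S ↔ ∀ l ∈ w.toWord, l.1 ∈ S := by
  refine ⟨fun h => ?_, fun h => by rw [← mk_toWord (x := w)]; exact mk_mem_supported h⟩
  induction h using Subgroup.closure_induction with
  | mem x hx => obtain ⟨y, hy, rfl⟩ := hx; simpa using hy
  | one => simp
  | mul x y _ _ hx hy =>
    intro l hl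
    rcases List.mem_append.1 ((toWord_mul_sublist x y).subset hl) with h | h
    exacts [hx l h, hy l h]
  | inv x _ hx =>
    intro l hl
    rw [toWord_inv] at hl
    simp only [invRev, List.mem_reverse, List.mem_map] at hl
    obtain ⟨a, ha, rfl⟩ := hl
    exact hx a ha

theorem isCyclicallyReduced_of_isReduced_append_self {L : List (α × Bool)}
    (h : IsReduced (L ++ L)) : IsCyclicallyReduced L := by
  unfold IsReduced at h
  rw [List.isChain_append] at h
  exact ⟨h.1, fun a ha b hb => h.2.2 a ha b hb⟩

theorem IsCyclicallyReduced.isReduced_three {L : List (α × Bool)} (h : IsCyclicallyReduced L) :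
    IsReduced (L ++ (L ++ L)) := by
  simpa [List.replicate] using (h.flatten_replicate 3).isReduced

theorem IsCyclicallyReduced.append_comm {L₁ L₂ : List (α × Bool)}
    (h : IsCyclicallyReduced (L₁ ++ L₂)) : IsCyclicallyReduced (L₂ ++ L₁) :=
  isCyclicallyReduced_of_isReduced_append_self
    (h.isReduced_three.infix ⟨L₁, L₂, by simp⟩)

/-- Peel off the last letter `l` of the conjugator. If it cancels against an end of `L₁`, it only
rotates `L₁`. If it cancels at neither end, the conjugate is reduced as written and is visibly not
cyclically reduced. -/
theorem IsCyclicallyReduced.isRotated_of_conj_mk {P : List (α × Bool)} (hP : IsReduced P) :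
    ∀ {L₁ L₂ : List (α × Bool)}, IsCyclicallyReduced L₁ → IsCyclicallyReduced L₂ →
      mk P * mk L₁ * (mk P)⁻¹ = mk L₂ → L₁.IsRotated L₂ := by
  classical
  induction P using List.reverseRecOn with
  | nil =>
    intro L₁ L₂ h₁ h₂ h
    have h' : mk L₁ = mk L₂ := by simpa [← one_eq_mk] using h
    have := reduce.sound h'
    rw [h₁.isReduced.reduce_eq, h₂.isReduced.reduce_eq] at this
    rw [this]
  | append_singleton P l ih =>
    intro L₁ L₂ h₁ h₂ h
    replace ih := @ih (hP.infix ⟨[], [l], by simp⟩)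
    rcases List.eq_nil_or_concat' L₁ with rfl | ⟨T', e, hL⟩
    · have h' : mk L₂ = mk [] := by rw [← h, ← one_eq_mk, mul_one, mul_inv_cancel]
      have := reduce.sound h'
      rw [h₂.isReduced.reduce_eq] at this
      rw [this]; rfl
    by_cases he : e = l
    · subst he
      have h1 := (hL ▸ h₁).append_comm
      refine (List.IsRotated.symm ?_).trans (ih h1 h₂ ?_)
      · rw [hL]; exact List.isRotated_append
      · rw [← h, hL, ← mul_mk, ← mul_mk, ← mul_mk]; group
    obtain ⟨f, T, hT⟩ := List.exists_cons_of_ne_nil (l := L₁) (by rw [hL]; simp)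
    by_cases hf : f = (l.1, !l.2)
    · subst hf
      have h1 : IsCyclicallyReduced ([(l.1, !l.2)] ++ T) := by rw [hT] at h₁; exact h₁
      refine (List.IsRotated.symm ?_).trans (ih h1.append_comm h₂ ?_)
      · rw [hT]; exact List.isRotated_append (l' := [_])
      · have : L₁ = [(l.1, !l.2)] ++ T := hT
        have hinv : mk [(l.1, !l.2)] = (mk [l])⁻¹ := by simp [inv_mk, invRev]
        rw [← h, this, ← mul_mk, ← mul_mk, ← mul_mk, hinv]; group
    exfalso
    have hred : IsReduced (P ++ [l] ++ L₁ ++ invRev (P ++ [l])) := by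
      have hinv : IsReduced (invRev (P ++ [l])) := by
        rw [isReduced_iff_reduce_eq, reduce_invRev, hP.reduce_eq]
      unfold IsReduced at *
      rw [List.isChain_append, List.isChain_append]
      refine ⟨⟨hP, h₁.isReduced, ?_⟩, hinv, ?_⟩
      · intro a ha b hb hab
        simp only [List.getLast?_append, List.getLast?_singleton, Option.some_or, Option.mem_def,
          Option.some.injEq] at ha
        rw [hT] at hb
        simp only [List.head?_cons, Option.mem_def, Option.some.injEq] at hb
        subst ha hb
        by_contra hne
        exact hf (Prod.ext hab.symm (by grind))
      · intro a ha b hb hab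
        rw [hL] at ha
        simp only [List.getLast?_append, List.getLast?_singleton, Option.some_or, Option.mem_def,
          Option.some.injEq] at ha
        have : invRev (P ++ [l]) = (l.1, !l.2) :: invRev P := by simp [invRev]
        rw [this] at hb
        simp only [List.head?_cons, Option.mem_def, Option.some.injEq] at hb
        subst ha hb
        by_contra hne
        simp only at hne hab
        exact he (Prod.ext hab (by grind))
    have hL₂ : L₂ = P ++ [l] ++ L₁ ++ invRev (P ++ [l]) := by
      have h' : mk L₂ = mk (P ++ [l] ++ L₁ ++ invRev (P ++ [l])) := by
        rw [← h, inv_mk, mul_mk, mul_mk]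
      have := reduce.sound h'
      rwa [h₂.isReduced.reduce_eq, hred.reduce_eq] at this
    -- The reduced form of the conjugate begins with `g` and ends with its inverse.
    obtain ⟨g, Q, hQ⟩ := List.exists_cons_of_ne_nil (l := P ++ [l]) (by simp)
    rw [hQ] at hL₂
    have h3 : L₂ = g :: (Q ++ L₁ ++ invRev Q) ++ [(g.1, !g.2)] := by
      rw [hL₂]; simp [invRev]
    rw [h3, isCyclicallyReduced_cons_append_iff] at h₂
    have := h₂.2 rfl
    simp at this

theorem IsCyclicallyReduced.isRotated_of_isConj {L₁ L₂ : List (α × Bool)}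
    (h₁ : IsCyclicallyReduced L₁) (h₂ : IsCyclicallyReduced L₂) (h : IsConj (mk L₁) (mk L₂)) :
    L₁.IsRotated L₂ := by
  classical
  obtain ⟨g, hg⟩ := isConj_iff.1 h
  refine isRotated_of_conj_mk (P := g.toWord) isReduced_toWord h₁ h₂ ?_
  rw [mk_toWord, hg]

theorem isConj_mk_reduceCyclically [DecidableEq α] (w : FreeGroup α) :
    IsConj (mk (reduceCyclically w.toWord)) w := by
  refine isConj_iff.2 ⟨mk (reduceCyclically.conjugator w.toWord), ?_⟩
  rw [inv_mk, mul_mk, mul_mk, reduceCyclically.conj_conjugator_reduceCyclically, mk_toWord]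

theorem isRotated_cyclicReduction_of_isConj [DecidableEq α] {w₁ w₂ : FreeGroup α}
    (h : IsConj w₁ w₂) : (cyclicReduction w₁).IsRotated (cyclicReduction w₂) :=
  (reduceCyclically.isCyclicallyReduced isReduced_toWord).isRotated_of_isConj
    (reduceCyclically.isCyclicallyReduced isReduced_toWord)
    ((isConj_mk_reduceCyclically w₁).trans (h.trans (isConj_mk_reduceCyclically w₂).symm))

theorem reduceCyclically_sublist [DecidableEq α] (L : List (α × Bool)) :
    (reduceCyclically L).Sublist L := by
  conv_rhs => rw [← reduceCyclically.conj_conjugator_reduceCyclically L]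
  exact (List.sublist_append_right _ _).trans (List.sublist_append_left _ _)

theorem cyclicReduction_eq_of_isCyclicallyReduced [DecidableEq α] {L : List (α × Bool)}
    (h : IsCyclicallyReduced L) : cyclicReduction (mk L) = L := by
  rw [cyclicReduction, toWord_mk, h.isReduced.reduce_eq]
  have hr : IsCyclicallyReduced (reduceCyclically L) :=
    reduceCyclically.isCyclicallyReduced h.isReduced
  have h2 := isConj_mk_reduceCyclically (mk L)
  rw [toWord_mk, h.isReduced.reduce_eq] at h2
  exact (reduceCyclically_sublist L).eq_of_length (hr.isRotated_of_isConj h h2).perm.length_eq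

/-- A conjugate of a cyclically reduced word can only lie in a subgroup generated by free generators
if all the letters of the word are among them. -/
theorem IsCyclicallyReduced.mem_of_isConj_supported {L : List (α × Bool)}
    (hL : IsCyclicallyReduced L) {S : Set α} {w : FreeGroup α} (hw : w ∈ supported S)
    (h : IsConj (mk L) w) : ∀ l ∈ L, l.1 ∈ S := by
  classical
  intro l hl
  have h1 := hL.isRotated_of_isConj
    (reduceCyclically.isCyclicallyReduced (isReduced_toWord (x := w)))
    (h.trans (isConj_mk_reduceCyclically w).symm)
  exact mem_supported_iff.1 hw l
    ((reduceCyclically_sublist _).subset ((h1.mem_iff).1 hl))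

end FreeGroup

/-! ### Residual finite-`p` properties and the Freiheitssatz for nonzero exponent sum -/

namespace FreeGroup

variable {α : Type*}

theorem exists_syllables {w : FreeGroup α} (hw : w ≠ 1) :
    ∃ l : List (α × ℤ), l ≠ [] ∧ (∀ s ∈ l, s.2 ≠ 0) ∧ l.IsChain (fun a b => a.1 ≠ b.1) ∧
      w = (l.map fun s => of s.1 ^ s.2).prod := by
  classical
  let f : FreeGroup α →* Monoid.CoprodI (fun _ : α => Multiplicative ℤ) :=
    lift fun i => Monoid.CoprodI.of (i := i) (Multiplicative.ofAdd 1)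
  let g : Monoid.CoprodI (fun _ : α => Multiplicative ℤ) →* FreeGroup α :=
    Monoid.CoprodI.lift fun i => zpowersHom _ (of i)
  have hgf : g.comp f = MonoidHom.id _ := by
    ext i; simp [f, g]
  let W := Monoid.CoprodI.Word.equiv (f w)
  have hW : W.prod = f w := Monoid.CoprodI.Word.equiv.symm_apply_apply (f w)
  have hprod : ∀ L : List (Σ _ : α, Multiplicative ℤ),
      g ((L.map fun s => Monoid.CoprodI.of (i := s.1) s.2).prod) =
        ((L.map fun s => (s.1, s.2.toAdd)).map fun s => of s.1 ^ s.2).prod := by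
    intro L
    induction L with
    | nil => simp
    | cons a L ih => simp only [List.map_cons, List.prod_cons, _root_.map_mul, ih]; simp [g]
  have hw' : w = g (f w) := by
    rw [← MonoidHom.comp_apply, hgf]; rfl
  refine ⟨W.toList.map fun s => (s.1, s.2.toAdd), ?_, ?_, ?_, ?_⟩
  · intro h
    have h0 : W.toList = [] := List.map_eq_nil_iff.1 h
    apply hw
    rw [hw', ← hW, Monoid.CoprodI.Word.prod, h0]
    simp
  · intro s hs
    obtain ⟨s', hs', rfl⟩ := List.mem_map.1 hs
    exact fun h => W.ne_one s' hs' h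
  · exact List.isChain_map_of_isChain (R := fun (a b : Σ _ : α, Multiplicative ℤ) => a.1 ≠ b.1)
      (fun s => (s.1, s.2.toAdd)) (fun a b h => h) W.chain_ne
  · rw [← hprod]
    exact hw'.trans (by rw [← hW]; rfl)

section Unitriangular

variable {R : Type*} [CommRing R] {n : ℕ}

theorem strictUpper_mul {M N : Matrix (Fin n) (Fin n) R} (hM : ∀ a b, b ≤ a → M a b = 0)
    (hN : ∀ a b, b ≤ a → N a b = 0) : ∀ a b, b ≤ a → (M * N) a b = 0 := by
  intro a b hab
  rw [Matrix.mul_apply]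
  refine Finset.sum_eq_zero fun c _ => ?_
  rcases le_or_gt c a with h | h
  · rw [hM a c h, zero_mul]
  · rw [hN c b (hab.trans h.le), mul_zero]

theorem strictUpper_pow_apply {N : Matrix (Fin n) (Fin n) R} (hN : ∀ a b, b ≤ a → N a b = 0)
    (m : ℕ) : ∀ a b : Fin n, (b : ℕ) < a + m → (N ^ m) a b = 0 := by
  induction m with
  | zero =>
    intro a b h
    rw [pow_zero, Matrix.one_apply_ne]
    rintro rfl
    omega
  | succ m ih =>
    intro a b h
    rw [pow_succ, Matrix.mul_apply]
    refine Finset.sum_eq_zero fun c _ => ?_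
    rcases lt_or_ge (c : ℕ) (a + m) with h1 | h1
    · rw [ih a c h1, zero_mul]
    · rw [hN c b (by rw [Fin.le_def]; omega), mul_zero]

/-- The group of upper unitriangular matrices over a finite ring. -/
def unitriangular (n : ℕ) (R : Type*) [CommRing R] [Finite R] :
    Subgroup (Matrix (Fin n) (Fin n) R)ˣ :=
  let S : Submonoid (Matrix (Fin n) (Fin n) R)ˣ :=
    { carrier := {g | ∀ a b, b ≤ a → (g.val - 1) a b = 0}
      one_mem' := by intro a b _; simp
      mul_mem' := by
        intro g h hg hh a b hab
        have : (g * h).val - 1 = (g.val - 1) * (h.val - 1) + (g.val - 1) + (h.val - 1) := by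
          rw [Units.val_mul]; noncomm_ring
        rw [this, Matrix.add_apply, Matrix.add_apply, strictUpper_mul hg hh a b hab, hg a b hab,
          hh a b hab]
        simp }
  { S with
    inv_mem' := by
      intro g hg
      -- In a finite group a submonoid is closed under inverses.
      have h1 : g⁻¹ = g ^ (orderOf g - 1) := by
        rw [inv_eq_iff_mul_eq_one, ← pow_succ', Nat.sub_add_cancel (orderOf_pos g),
          pow_orderOf_eq_one]
      rw [h1]
      exact pow_mem (S := S) hg _ }

theorem mem_unitriangular [Finite R] {g : (Matrix (Fin n) (Fin n) R)ˣ} :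
    g ∈ unitriangular n R ↔ ∀ a b, b ≤ a → (g.val - 1) a b = 0 := Iff.rfl

theorem isPGroup_unitriangular (n p : ℕ) [hp : Fact p.Prime] :
    IsPGroup p (unitriangular (n + 1) (ZMod p)) := by
  rintro ⟨g, hg⟩
  refine ⟨n + 1, Subtype.ext (Units.ext ?_)⟩
  have hN := strictUpper_pow_apply (mem_unitriangular.1 hg) (p ^ (n + 1))
  have h0 : (g.val - 1) ^ p ^ (n + 1) = 0 := by
    ext a b
    refine hN a b ?_
    have : n + 1 < p ^ (n + 1) := Nat.lt_pow_self hp.out.one_lt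
    omega
  have h1 : g.val = 1 + (g.val - 1) := by abel
  have h2 : g.val ^ p ^ (n + 1) = 1 := by
    rw [h1, add_pow_char_pow_of_commute _ _ (Commute.one_left _), one_pow, h0, add_zero]
  simpa using h2

end Unitriangular

/-- The matrix whose superdiagonal marks the positions of the letter `y` in the word `l`. -/
noncomputable def superdiagonal (R : Type*) [CommRing R] (l : List (α × ℤ)) (y : α) :
    Matrix (Fin (l.length + 1)) (Fin (l.length + 1)) R := by
  classical
  exact fun a b => if (b : ℕ) = a + 1 ∧ (l[(a : ℕ)]?).map Prod.fst = some y then 1 else 0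

/-- A nonzero entry of the square would need the letter `y` at two consecutive positions, which the
chain condition forbids. -/
theorem superdiagonal_mul_self (R : Type*) [CommRing R] {l : List (α × ℤ)}
    (hl : l.IsChain (fun a b => a.1 ≠ b.1)) (y : α) :
    superdiagonal R l y * superdiagonal R l y = 0 := by
  ext a b
  rw [Matrix.mul_apply]
  refine Finset.sum_eq_zero fun c _ => ?_
  by_contra h
  have h1 := left_ne_zero_of_mul h
  have h2 := right_ne_zero_of_mul h
  simp only [superdiagonal, ne_eq, ite_eq_right_iff, not_forall] at h1 h2
  obtain ⟨⟨hc, ha⟩, -⟩ := h1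
  obtain ⟨⟨-, hc'⟩, -⟩ := h2
  rw [hc] at hc'
  rw [Option.map_eq_some_iff] at ha hc'
  obtain ⟨s, hs, rfl⟩ := ha
  obtain ⟨s', hs', hss⟩ := hc'
  obtain ⟨i1, rfl⟩ := List.getElem?_eq_some_iff.1 hs
  obtain ⟨i2, rfl⟩ := List.getElem?_eq_some_iff.1 hs'
  exact List.isChain_iff_getElem.1 hl a i2 hss.symm

/-- The unipotent one-parameter group `e ↦ 1 + e X` for a matrix `X` of square zero. -/
def unipotentHom {A : Type*} [Ring A] (X : A) (hX : X * X = 0) : Multiplicative ℤ →* Aˣ where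
  toFun e :=
    { val := 1 + e.toAdd • X
      inv := 1 - e.toAdd • X
      val_inv := by
        simp only [mul_sub, add_mul, mul_one, one_mul, smul_mul_smul_comm, hX, smul_zero]
        abel
      inv_val := by
        simp only [mul_add, sub_mul, mul_one, one_mul, smul_mul_smul_comm, hX, smul_zero]
        abel }
  map_one' := by ext; simp
  map_mul' e f := by
    ext
    simp only [toAdd_mul, Units.val_mul, mul_add, add_mul, mul_one, one_mul, smul_mul_smul_comm, hX,
      smul_zero, add_zero, add_smul]
    abel

/-- Each factor moves at most one step along the superdiagonal. Reaching column `m` from row `0` in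
`m` factors therefore requires a step in each of them, and the step of a syllable contributes its
exponent. -/
theorem prod_take_apply (R : Type*) [CommRing R] (l : List (α × ℤ)) (m : ℕ) (hm : m ≤ l.length) :
    (((l.take m).map fun s => 1 + s.2 • superdiagonal R l s.1).prod 0 ⟨m, by omega⟩ =
        ((l.take m).map fun s => (s.2 : R)).prod) ∧
    ∀ j : Fin (l.length + 1), m < j →
      ((l.take m).map fun s => 1 + s.2 • superdiagonal R l s.1).prod 0 j = 0 := by
  induction m with
  | zero =>
    refine ⟨by simp, fun j hj => ?_⟩
    simp only [List.take_zero, List.map_nil, List.prod_nil]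
    rw [Matrix.one_apply_ne]
    rintro rfl
    exact absurd hj (by simp)
  | succ m ih =>
    obtain ⟨ih1, ih2⟩ := ih (by omega)
    have hlt : m < l.length := by omega
    rw [List.take_succ_eq_append_getElem hlt]
    simp only [List.map_append, List.map_cons, List.map_nil, List.prod_append, List.prod_singleton]
    set P := ((l.take m).map fun s => 1 + s.2 • superdiagonal R l s.1).prod with hP
    have key : ∀ j : Fin (l.length + 1), m < j →
        (P * (1 + l[m].2 • superdiagonal R l l[m].1)) 0 j =
          if (j : ℕ) = m + 1 then P 0 ⟨m, by omega⟩ * (l[m].2 : R) else 0 := by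
      intro j hj
      rw [mul_add, mul_one, Matrix.add_apply, ih2 j hj, zero_add, Matrix.mul_apply]
      split_ifs with hjm
      · rw [Finset.sum_eq_single (⟨m, by omega⟩ : Fin (l.length + 1))]
        · simp [superdiagonal, hjm, List.getElem?_eq_getElem hlt]
        · intro c _ hc
          have : (j : ℕ) ≠ c + 1 := fun h => hc (Fin.ext (by simp only; omega))
          simp [superdiagonal, this]
        · simp
      · refine Finset.sum_eq_zero fun c _ => ?_
        by_cases hc : (j : ℕ) = c + 1
        · rw [ih2 c (by omega), zero_mul]
        · simp [superdiagonal, hc]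
    refine ⟨?_, fun j hj => ?_⟩
    · rw [key _ (by simp), if_pos rfl, ih1]
    · rw [key _ (by omega), if_neg (by omega)]

/-- Free groups are residually finite-`p` for all large primes, with a bound depending on the
element. -/
theorem exists_isPGroup_hom_ne_one {w : FreeGroup α} (hw : w ≠ 1) :
    ∃ N : ℕ, ∀ p : ℕ, p.Prime → N < p → ∃ (U : Type) (_ : Group U) (_ : Finite U),
      IsPGroup p U ∧ ∃ ψ : FreeGroup α →* U, ψ w ≠ 1 := by
  obtain ⟨l, hne, h0, hch, rfl⟩ := exists_syllables hw
  -- A prime above this sum divides no syllable exponent, so the corner entry of the image, the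
  -- product of the exponents, stays nonzero modulo `p`.
  refine ⟨(l.map fun s => s.2.natAbs).sum, fun p hp hNp => ?_⟩
  have : Fact p.Prime := ⟨hp⟩
  let X := superdiagonal (ZMod p) l
  let g : α → (Matrix (Fin (l.length + 1)) (Fin (l.length + 1)) (ZMod p))ˣ := fun y =>
    unipotentHom (X y) (superdiagonal_mul_self _ hch y) (Multiplicative.ofAdd 1)
  have hg : ∀ y, g y ∈ unitriangular (l.length + 1) (ZMod p) := by
    intro y
    rw [mem_unitriangular]
    intro a b hab
    have h1 : (b : ℕ) ≠ a + 1 := by rw [Fin.le_def] at hab; omega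
    simp [g, unipotentHom, X, superdiagonal, h1]
  let ψ : FreeGroup α →* unitriangular (l.length + 1) (ZMod p) := lift fun y => ⟨g y, hg y⟩
  have hψ : (unitriangular (l.length + 1) (ZMod p)).subtype.comp ψ = lift g := by
    ext1 y; simp [ψ]
  refine ⟨unitriangular (l.length + 1) (ZMod p), inferInstance, inferInstance,
    isPGroup_unitriangular _ p, ψ, fun h => ?_⟩
  have hval : ∀ L : List (α × ℤ), (lift g (L.map fun s => of s.1 ^ s.2).prod).val =
      (L.map fun s => 1 + s.2 • X s.1).prod := by
    intro L
    induction L with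
    | nil => simp
    | cons s L ih =>
      rw [List.map_cons, List.prod_cons, _root_.map_mul, Units.val_mul, ih, List.map_cons, List.prod_cons,
        map_zpow, lift_apply_of]
      congr 1
      simp only [g]
      rw [← map_zpow]
      simp [unipotentHom]
  have h1 := hval l
  rw [← hψ, MonoidHom.comp_apply, h, _root_.map_one, Units.val_one] at h1
  have h2 := (prod_take_apply (ZMod p) l l.length le_rfl).1
  rw [List.take_length, ← h1] at h2
  have hpos : 0 < l.length := List.length_pos_iff.2 hne
  rw [Matrix.one_apply_ne
    (by intro h; simpa [hpos.ne] using congrArg Fin.val h)] at h2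
  have h3 : (0 : ZMod p) ∈ l.map fun s => (s.2 : ZMod p) := List.prod_eq_zero_iff.1 h2.symm
  obtain ⟨s, hs, hs0⟩ := List.mem_map.1 h3
  rw [ZMod.intCast_zmod_eq_zero_iff_dvd] at hs0
  have h4 : s.2.natAbs ≤ (l.map fun s => s.2.natAbs).sum :=
    List.single_le_sum (by simp) _ (List.mem_map.2 ⟨s, hs, rfl⟩)
  have h5 := Nat.le_of_dvd (Int.natAbs_pos.2 (h0 s hs)) (Int.natCast_dvd.1 hs0)
  omega

/-- The exponent sum of the letter `x`. -/
def exponentSum [DecidableEq α] (x : α) : FreeGroup α →* Multiplicative ℤ :=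
  lift fun y => if y = x then Multiplicative.ofAdd 1 else 1

/-- The factors `π h` introduced at the occurrences of `x` can be collected because they commute
with the whole image of `π`. -/
theorem lift_mul_central_apply [DecidableEq α] {U V : Type*} [Group U] [Group V] (π : U →* V)
    (ψ : FreeGroup α →* U) {h : U} (hcen : ∀ g, Commute (π h) (π g)) (x : α) (w : FreeGroup α) :
    π (lift (fun y => if y = x then ψ (of x) * h else ψ (of y)) w) =
      π (ψ w) * π h ^ (exponentSum x w).toAdd := by
  let χ : FreeGroup α →* V :=
    { toFun := fun w => π (ψ w) * π h ^ (exponentSum x w).toAdd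
      map_one' := by simp
      map_mul' := by
        intro w w'
        simp only [_root_.map_mul, toAdd_mul, zpow_add]
        have := ((hcen (ψ w')).zpow_left (exponentSum x w).toAdd).eq
        simp only [mul_assoc]
        rw [← mul_assoc (π (ψ w')), ← this, mul_assoc] }
  have hχ : π.comp (lift fun y => if y = x then ψ (of x) * h else ψ (of y)) = χ := by
    ext1 y
    by_cases hy : y = x
    · subst hy; simp [χ, exponentSum]
    · simp [χ, exponentSum, hy]
  exact DFunLike.congr_fun hχ w

/-- The equation `r = 1` is solved for the image of `x` by successive approximation down the lower
central series. A correction `h` in the current term is central modulo the next, so it multiplies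
the value of `r` by `h ^ k`, and `k`-th roots exist in a `p`-group when `p ∤ k`. -/
theorem exists_hom_eq_one_of_isPGroup [DecidableEq α] {U : Type*} [Group U] [Finite U] {p : ℕ}
    [hp : Fact p.Prime] (hU : IsPGroup p U) (ψ : FreeGroup α →* U) (x : α) (r : FreeGroup α)
    (hr : ¬ (p : ℤ) ∣ (exponentSum x r).toAdd) :
    ∃ ψ' : FreeGroup α →* U, (∀ y ≠ x, ψ' (of y) = ψ (of y)) ∧ ψ' r = 1 := by
  set k := (exponentSum x r).toAdd with hk
  have main : ∀ m : ℕ, ∃ ψ' : FreeGroup α →* U, (∀ y ≠ x, ψ' (of y) = ψ (of y)) ∧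
      ψ' r ∈ Subgroup.lowerCentralSeries (⊤ : Subgroup U) m := by
    intro m
    induction m with
    | zero => exact ⟨ψ, fun _ _ => rfl, by simp⟩
    | succ m ih =>
      obtain ⟨ψ', h1, h2⟩ := ih
      obtain ⟨s, hs⟩ := hU (ψ' r)
      have hcop : IsCoprime k ((p : ℤ) ^ s) :=
        (((Nat.prime_iff_prime_int.1 hp.out).coprime_iff_not_dvd.2 hr).symm).pow_right
      obtain ⟨a, b, hab⟩ := hcop
      let h := (ψ' r) ^ (-a)
      have hhk : h ^ k = (ψ' r)⁻¹ := by
        have : -a * k = -1 + (p ^ s : ℕ) * b := by push_cast; linarith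
        rw [← zpow_mul, this, zpow_add, zpow_mul, zpow_natCast, hs]
        simp
      have hh : h ∈ Subgroup.lowerCentralSeries (⊤ : Subgroup U) m := zpow_mem h2 _
      let π := QuotientGroup.mk' (Subgroup.lowerCentralSeries (⊤ : Subgroup U) (m + 1))
      have hcen : ∀ g : U, Commute (π h) (π g) := by
        intro g
        rw [← commutatorElement_eq_one_iff_commute, ← map_commutatorElement]
        exact (QuotientGroup.eq_one_iff _).2
          (Subgroup.commutator_mem_commutator hh (Subgroup.mem_top g))
      let ψ'' : FreeGroup α →* U := lift fun y => if y = x then ψ' (of x) * h else ψ' (of y)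
      refine ⟨ψ'', fun y hy => by simp [ψ'', hy, h1 y hy], ?_⟩
      have h3 : π (ψ'' r) = 1 := by
        rw [lift_mul_central_apply π ψ' hcen x r, ← hk, ← map_zpow, hhk, ← _root_.map_mul, mul_inv_cancel, _root_.map_one]
      exact (QuotientGroup.eq_one_iff _).1 h3
  have : Group.IsNilpotent U := hU.isNilpotent
  obtain ⟨n, hn⟩ := Subgroup.nilpotent_iff_lowerCentralSeries.1 this
  obtain ⟨ψ', h1, h2⟩ := main n
  rw [hn, Subgroup.mem_bot] at h2
  exact ⟨ψ', h1, h2⟩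

theorem eqOn_supported {G : Type*} [Group G] {f g : FreeGroup α →* G} {S : Set α}
    (h : ∀ y ∈ S, f (of y) = g (of y)) {w : FreeGroup α} (hw : w ∈ supported S) : f w = g w := by
  have : supported S ≤ f.eqLocus g := by
    rw [supported, Subgroup.closure_le]
    rintro _ ⟨y, hy, rfl⟩
    exact h y hy
  exact this hw

theorem map_eq_one_of_mem_normalClosure {G H : Type*} [Group G] [Group H] {r w : G} (f : G →* H)
    (hr : f r = 1) (hw : w ∈ Subgroup.normalClosure {r}) : f w = 1 :=
  (Subgroup.normalClosure_le_normal (N := f.ker)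
    (by simpa using hr)) hw

/-- The Freiheitssatz for a relator in which the omitted letter has nonzero exponent sum. -/
theorem eq_one_of_exponentSum_ne_zero [DecidableEq α] {x : α} {r : FreeGroup α}
    (hr : exponentSum x r ≠ 1) {w : FreeGroup α} (hw : w ∈ supported {x}ᶜ)
    (hwr : w ∈ Subgroup.normalClosure {r}) : w = 1 := by
  by_contra hne
  obtain ⟨N, hN⟩ := exists_isPGroup_hom_ne_one hne
  -- The prime must exceed the bound that detects `w` and must not divide the exponent sum of `x` in
  -- `r`.
  obtain ⟨p, hpN, hp⟩ := Nat.exists_infinite_primes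
    (max (N + 1) ((exponentSum x r).toAdd.natAbs + 1))
  obtain ⟨U, _, _, hU, ψ, hψ⟩ := hN p hp (by omega)
  have : Fact p.Prime := ⟨hp⟩
  obtain ⟨ψ', h1, h2⟩ := exists_hom_eq_one_of_isPGroup hU ψ x r fun hdvd => by
    have := Nat.le_of_dvd (Int.natAbs_pos.2 (by simpa using hr)) (Int.natCast_dvd.1 hdvd)
    omega
  apply hψ
  rw [← eqOn_supported h1 hw]
  exact map_eq_one_of_mem_normalClosure ψ' h2 hwr

end FreeGroup

/-! ### Magnus rewriting, HNN extensions and the Freiheitssatz -/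

namespace FreeGroup

variable {α : Type*}

theorem norm_map_le [DecidableEq α] {β : Type*} [DecidableEq β] (f : α → β) (w : FreeGroup α) :
    (map f w).norm ≤ w.norm := by
  conv_lhs => rw [← mk_toWord (x := w), map.mk]
  exact norm_mk_le.trans (by simp [norm])

theorem map_mem_supported {β : Type*} {f : α → β} {S : Set α} {T : Set β}
    (h : ∀ y ∈ S, f y ∈ T) {w : FreeGroup α} (hw : w ∈ supported S) : map f w ∈ supported T := by
  have : supported S ≤ (supported T).comap (map f) := by
    rw [supported, Subgroup.closure_le]
    rintro _ ⟨y, hy, rfl⟩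
    simpa using of_mem_supported (h y hy)
  exact this hw

theorem IsCyclicallyReduced.map {β : Type*} {f : α → β} (hf : Function.Injective f)
    {L : List (α × Bool)} (hL : IsCyclicallyReduced L) :
    IsCyclicallyReduced (L.map fun l => (f l.1, l.2)) := by
  refine ⟨?_, ?_⟩
  · have := hL.isReduced
    unfold IsReduced at *
    rw [List.isChain_map]
    exact this.imp fun a b h hab => h (hf hab)
  · intro a ha b hb hab
    rw [List.getLast?_map, Option.mem_def, Option.map_eq_some_iff] at ha
    rw [List.head?_map, Option.mem_def, Option.map_eq_some_iff] at hb
    obtain ⟨a, ha, rfl⟩ := ha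
    obtain ⟨b, hb, rfl⟩ := hb
    exact hL.2 a ha b hb (hf hab)

theorem mem_normalClosure_singleton_of_isConj {G : Type*} [Group G] {r s : G} (h : IsConj s r) :
    r ∈ Subgroup.normalClosure {s} := by
  obtain ⟨g, rfl⟩ := isConj_iff.1 h
  have hs : s ∈ Subgroup.normalClosure {s} := Subgroup.subset_normalClosure rfl
  exact Subgroup.Normal.conj_mem inferInstance s hs g

theorem normalClosure_singleton_eq_of_isConj {G : Type*} [Group G] {r s : G} (h : IsConj r s) :
    Subgroup.normalClosure {r} = Subgroup.normalClosure {s} :=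
  le_antisymm
    (Subgroup.normalClosure_le_normal (Set.singleton_subset_iff.2
      (mem_normalClosure_singleton_of_isConj h.symm)))
    (Subgroup.normalClosure_le_normal (Set.singleton_subset_iff.2
      (mem_normalClosure_singleton_of_isConj h)))

section Levels

/-- The translation of the levels of the free generators `(y, i)` by `n`. -/
def levelShift (n : ℤ) : FreeGroup (α × ℤ) →* FreeGroup (α × ℤ) := map fun p => (p.1, p.2 + n)

theorem levelShift_of (n : ℤ) (p : α × ℤ) : levelShift n (of p) = of (p.1, p.2 + n) := map.of

theorem levelShift_levelShift (m n : ℤ) (w : FreeGroup (α × ℤ)) :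
    levelShift m (levelShift n w) = levelShift (n + m) w := by
  have : (levelShift m).comp (levelShift n) = levelShift (α := α) (n + m) := by
    ext1 p
    rw [MonoidHom.comp_apply, levelShift_of, levelShift_of, levelShift_of, add_assoc]
  exact DFunLike.congr_fun this w

theorem levelShift_zero (w : FreeGroup (α × ℤ)) : levelShift 0 w = w := by
  have : levelShift (α := α) 0 = MonoidHom.id _ := by
    ext1 p
    rw [levelShift_of, add_zero]; rfl
  exact DFunLike.congr_fun this w

/-- The action of `ℤ` on the free group on `α × ℤ` by translation of levels. -/
def levelAction (α : Type*) : Multiplicative ℤ →* MulAut (FreeGroup (α × ℤ)) where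
  toFun n :=
    { levelShift n.toAdd with
      invFun := levelShift (-n.toAdd)
      left_inv := fun w => by
        change levelShift _ (levelShift _ w) = w
        rw [levelShift_levelShift, add_neg_cancel, levelShift_zero]
      right_inv := fun w => by
        change levelShift _ (levelShift _ w) = w
        rw [levelShift_levelShift, neg_add_cancel, levelShift_zero] }
  map_one' := MulEquiv.ext levelShift_zero
  map_mul' m n := MulEquiv.ext fun w =>
    ((levelShift_levelShift m.toAdd n.toAdd w).trans (by rw [add_comm]; rfl)).symm

theorem levelAction_apply (n : Multiplicative ℤ) (w : FreeGroup (α × ℤ)) :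
    levelAction α n w = levelShift n.toAdd w := rfl

/-- The homomorphism sending the generator `(y, i)` to `x ^ i * y * x ^ (-i)`. -/
def ofLevels (x : α) : FreeGroup (α × ℤ) →* FreeGroup α :=
  lift fun p => of x ^ p.2 * of p.1 * (of x ^ p.2)⁻¹

theorem ofLevels_levelShift (x : α) (n : ℤ) (w : FreeGroup (α × ℤ)) :
    ofLevels x (levelShift n w) = of x ^ n * ofLevels x w * (of x ^ n)⁻¹ := by
  have : (ofLevels x).comp (levelShift n) = (MulAut.conj (of x ^ n)).toMonoidHom.comp
      (ofLevels x) := by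
    ext1 p
    simp only [ofLevels, levelShift, MonoidHom.comp_apply, map.of, lift_apply_of,
      MulEquiv.coe_toMonoidHom, MulAut.conj_apply]
    rw [add_comm, zpow_add]
    group
  exact DFunLike.congr_fun this w

theorem ofLevels_map_zero (x : α) (w : FreeGroup α) :
    ofLevels x (map (fun y => (y, 0)) w) = w := by
  have : (ofLevels x).comp (map fun y => (y, 0)) = MonoidHom.id _ := by
    ext1 y; simp [ofLevels]
  exact DFunLike.congr_fun this w

variable [DecidableEq α]

/-- The decomposition of a word with respect to the stable letter `x`. -/
def levelHom (x : α) : FreeGroup α →* FreeGroup (α × ℤ) ⋊[levelAction α] Multiplicative ℤ :=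
  lift fun y => if y = x then ⟨1, Multiplicative.ofAdd 1⟩ else ⟨of (y, 0), 1⟩

theorem levelHom_right (x : α) (w : FreeGroup α) : (levelHom x w).right = exponentSum x w := by
  have : SemidirectProduct.rightHom.comp (levelHom x) = exponentSum x := by
    ext1 y
    simp only [levelHom, exponentSum, MonoidHom.comp_apply, lift_apply_of]
    split_ifs <;> simp
  exact DFunLike.congr_fun this w

theorem ofLevels_levelHom_left (x : α) {w : FreeGroup α} (hw : exponentSum x w = 1) :
    ofLevels x (levelHom x w).left = w := by
  let f : FreeGroup (α × ℤ) ⋊[levelAction α] Multiplicative ℤ →* FreeGroup α :=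
    SemidirectProduct.lift (ofLevels x) (zpowersHom _ (of x)) (by
      intro n
      ext1 p
      have h := ofLevels_levelShift x n.toAdd (of p)
      rw [← MulAut.conj_apply] at h
      exact h)
  have h : f.comp (levelHom x) = MonoidHom.id _ := by
    ext1 y
    simp only [levelHom, MonoidHom.comp_apply, lift_apply_of, f]
    split_ifs with hy
    · subst hy; simp [SemidirectProduct.lift]
    · simp [SemidirectProduct.lift, ofLevels]
  have h1 := DFunLike.congr_fun h w
  simpa [f, SemidirectProduct.lift, levelHom_right, hw] using h1

/-- Occurrences of `x` only shift the levels of later letters and disappear from the rewritten word.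
This makes the Magnus induction decrease as soon as `x` occurs. -/
theorem levelHom_mk_left (x : α) (L : List (α × Bool)) :
    (levelHom x (mk L)).left ∈ supported {p : α × ℤ | p.1 ≠ x} ∧
      (levelHom x (mk L)).left.norm ≤ (L.filter fun l => l.1 ≠ x).length := by
  induction L with
  | nil => rw [← one_eq_mk, _root_.map_one]; simp
  | cons a L ih =>
    have h1 : mk (a :: L) = mk [a] * mk L := by rw [mul_mk]; rfl
    have hs : ∀ n (w : FreeGroup (α × ℤ)), w ∈ supported {p : α × ℤ | p.1 ≠ x} →
        levelShift n w ∈ supported {p : α × ℤ | p.1 ≠ x} := fun n w hw =>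
      map_mem_supported (f := fun p : α × ℤ => (p.1, p.2 + n)) (fun y hy => hy) hw
    have h2 : (levelHom x (mk [a])).left ∈ supported {p : α × ℤ | p.1 ≠ x} ∧
        (levelHom x (mk [a])).left.norm ≤ if a.1 ≠ x then 1 else 0 := by
      obtain ⟨y, c⟩ := a
      have h3 : (levelHom x (of y)).left ∈ supported {p : α × ℤ | p.1 ≠ x} ∧
          (levelHom x (of y)).left.norm ≤ if y ≠ x then 1 else 0 := by
        by_cases hy : y = x
        · simp [levelHom, hy]
        · simpa [levelHom, hy] using of_mem_supported (S := {p : α × ℤ | p.1 ≠ x}) (x := (y, 0)) hy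
      cases c
      · have : mk [(y, false)] = (of y)⁻¹ := rfl
        rw [this, _root_.map_inv, SemidirectProduct.inv_left, levelAction_apply]
        exact ⟨hs _ _ (inv_mem h3.1), (norm_map_le _ _).trans (by rw [norm_inv_eq]; exact h3.2)⟩
      · exact h3
    rw [h1, _root_.map_mul, SemidirectProduct.mul_left, levelAction_apply]
    refine ⟨mul_mem h2.1 (hs _ _ ih.1), (norm_mul_le _ _).trans ?_⟩
    have h4 := (norm_map_le (fun p : α × ℤ => (p.1, p.2 +
      (levelHom x (mk [a])).right.toAdd)) (levelHom x (mk L)).left).trans ih.2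
    refine (add_le_add h2.2 h4).trans ?_
    by_cases ha : a.1 = x <;> simp [ha]
    omega

theorem exponentSum_eq_of_isConj (x : α) {r s : FreeGroup α} (h : IsConj r s) :
    exponentSum x r = exponentSum x s := isConj_iff_eq.1 ((exponentSum x).map_isConj h)

/-- A relator with exponent sum zero in `x` is, up to conjugation, a shorter cyclically reduced
word in the conjugates of the other generators by powers of `x`. -/
theorem exists_levels {x : α} {r : FreeGroup α} (hr : exponentSum x r = 1)
    (hx : ∀ w ∈ supported {x}ᶜ, ¬ IsConj r w) :
    ∃ (L : List ((α × ℤ) × Bool)) (M : ℤ), 1 ≤ M ∧ IsCyclicallyReduced L ∧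
      IsConj (ofLevels x (mk L)) r ∧
      (∀ l ∈ L, l.1.1 ≠ x ∧ 0 ≤ l.1.2 ∧ l.1.2 ≤ M) ∧
      (∃ l ∈ L, l.1.2 = 0) ∧ (∃ l ∈ L, l.1.2 = M) ∧
      L.length < (cyclicReduction r).length := by
  set L₀ := cyclicReduction r with hL₀
  have hconj : IsConj (mk L₀) r := isConj_mk_reduceCyclically r
  have hex : exponentSum x (mk L₀) = 1 := by rw [exponentSum_eq_of_isConj x hconj, hr]
  obtain ⟨l₀, hl₀, hl₀x⟩ : ∃ l ∈ L₀, l.1 = x := by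
    by_contra! h
    exact hx _ (mk_mem_supported fun l hl => h l hl) hconj.symm
  set s := (levelHom x (mk L₀)).left with hs
  have hsr : ofLevels x s = mk L₀ := ofLevels_levelHom_left x hex
  obtain ⟨hsupp, hnorm⟩ := levelHom_mk_left x L₀
  have hlt : s.norm < L₀.length := by
    refine hnorm.trans_lt (List.length_filter_lt_length_iff_exists.2 ⟨l₀, hl₀, by simp [hl₀x]⟩)
  set L₁ := cyclicReduction s with hL₁
  have hc₁ : IsCyclicallyReduced L₁ := reduceCyclically.isCyclicallyReduced isReduced_toWord
  have hlen : L₁.length ≤ s.norm := (reduceCyclically_sublist s.toWord).length_le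
  have hL₁x : ∀ l ∈ L₁, l.1.1 ≠ x := fun l hl =>
    mem_supported_iff.1 hsupp l ((reduceCyclically_sublist s.toWord).subset hl)
  have hconj₁ : IsConj (ofLevels x (mk L₁)) r := by
    refine IsConj.trans ?_ hconj
    rw [← hsr]
    exact (ofLevels x).map_isConj (isConj_mk_reduceCyclically s)
  have hne : L₁ ≠ [] := by
    intro h
    rw [h, ← one_eq_mk, _root_.map_one] at hconj₁
    exact hx 1 (one_mem _) hconj₁.symm
  have hne' : (L₁.map fun l => l.1.2).toFinset.Nonempty := by simpa using hne
  set I := (L₁.map fun l => l.1.2).toFinset with hI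
  have hIL : ∀ l ∈ L₁, l.1.2 ∈ I := fun l hl => by
    rw [hI, List.mem_toFinset]; exact List.mem_map.2 ⟨l, hl, rfl⟩
  have hLI : ∀ i ∈ I, ∃ l ∈ L₁, l.1.2 = i := fun i hi => by
    rw [hI, List.mem_toFinset] at hi; exact List.mem_map.1 hi
  set μ := I.min' hne' with hμ
  obtain ⟨l₁, hl₁, hl₁μ⟩ := hLI μ (I.min'_mem hne')
  obtain ⟨l₂, hl₂, hl₂M⟩ := hLI (I.max' hne') (I.max'_mem hne')
  -- Normalises the lowest level to `0`. On the original group this is conjugation by a power of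
  -- `x`.
  let f : α × ℤ → α × ℤ := fun p => (p.1, p.2 + -μ)
  have hf : Function.Injective f := by
    rintro ⟨y, i⟩ ⟨z, j⟩ h
    simp only [f, Prod.mk.injEq, add_left_inj] at h
    exact Prod.ext h.1 h.2
  have hmk : mk (L₁.map fun l => (f l.1, l.2)) = levelShift (-μ) (mk L₁) := rfl
  have hconj₂ : IsConj (ofLevels x (mk (L₁.map fun l => (f l.1, l.2)))) r := by
    refine IsConj.trans ?_ hconj₁
    rw [hmk, ofLevels_levelShift]
    exact (isConj_iff.2 ⟨_, rfl⟩ : IsConj (ofLevels x (mk L₁)) _).symm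
  have hle : ∀ l ∈ L₁, μ ≤ l.1.2 ∧ l.1.2 ≤ I.max' hne' := fun l hl =>
    ⟨I.min'_le _ (hIL l hl), I.le_max' _ (hIL l hl)⟩
  refine ⟨L₁.map fun l => (f l.1, l.2), I.max' hne' - μ, ?_, hc₁.map hf, hconj₂, ?_, ?_, ?_, ?_⟩
  -- If only one level occurred, `r` would be conjugate to a word without `x`.
  · by_contra hM
    refine hx (ofLevels x (mk (L₁.map fun l => (f l.1, l.2)))) ?_ hconj₂.symm
    have h1 : mk (L₁.map fun l => (f l.1, l.2)) = map (fun y => (y, 0)) (mk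
        (L₁.map fun l => (l.1.1, l.2))) := by
      rw [map.mk, List.map_map]
      congr 1
      refine List.map_congr_left fun l hl => ?_
      have := hle l hl
      simp only [f, Function.comp_apply, Prod.mk.injEq, and_true, true_and]
      omega
    rw [h1, ofLevels_map_zero]
    refine mk_mem_supported fun l hl => ?_
    obtain ⟨l', hl', rfl⟩ := List.mem_map.1 hl
    exact hL₁x l' hl'
  · intro l hl
    obtain ⟨l', hl', rfl⟩ := List.mem_map.1 hl
    have := hle l' hl'
    exact ⟨hL₁x l' hl', by simp only [f]; omega, by simp only [f]; omega⟩
  · exact ⟨_, List.mem_map.2 ⟨l₁, hl₁, rfl⟩, by simp only [f]; omega⟩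
  · exact ⟨_, List.mem_map.2 ⟨l₂, hl₂, rfl⟩, by simp only [f]; omega⟩
  · rw [List.length_map]; exact hlen.trans_lt hlt

/-- If the levels below the top one and the levels above the bottom one freely generate free
subgroups of the one-relator group on the levels `0, …, M`, then this group embeds in the
one-relator group in which the levels are conjugates by the stable letter `x`. -/
theorem mem_normalClosure_of_ofLevels_mem {x : α} {M : ℤ} {r : FreeGroup (α × ℤ)}
    (hr : r ∈ supported {p : α × ℤ | p.1 ≠ x ∧ 0 ≤ p.2 ∧ p.2 ≤ M})
    (hA : ∀ w ∈ supported {p : α × ℤ | p.2 < M}, w ∈ Subgroup.normalClosure {r} → w = 1)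
    (hB : ∀ w ∈ supported {p : α × ℤ | 0 < p.2}, w ∈ Subgroup.normalClosure {r} → w = 1)
    {w : FreeGroup (α × ℤ)}
    (hw : w ∈ supported {p : α × ℤ | p.1 ≠ x ∧ 0 ≤ p.2 ∧ p.2 ≤ M})
    (hwr : ofLevels x w ∈ Subgroup.normalClosure {ofLevels x r}) :
    w ∈ Subgroup.normalClosure {r} := by
  let G := FreeGroup (α × ℤ) ⧸ Subgroup.normalClosure {r}
  let π : FreeGroup (α × ℤ) →* G := QuotientGroup.mk' _
  have hπ : ∀ w, π w = 1 ↔ w ∈ Subgroup.normalClosure {r} := fun w => QuotientGroup.eq_one_iff w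
  -- By `hA` and `hB`, the levels `0, …, M - 1` and their shifts `1, …, M` embed in `G`. The shift
  -- is therefore an isomorphism of subgroups, and it is realised by the stable letter of an HNN
  -- extension.
  let S : Set (α × ℤ) := {p | 0 ≤ p.2 ∧ p.2 < M}
  let fA : supported S →* G := π.comp (supported S).subtype
  let fB : supported S →* G := (π.comp (levelShift 1)).comp (supported S).subtype
  have hfA : Function.Injective fA := by
    refine (injective_iff_map_eq_one _).2 fun w h => Subtype.ext (hA w.1 ?_ ((hπ _).1 h))
    exact supported_mono (fun p hp => hp.2) w.2
  have hshift : Function.Injective (levelShift (α := α) 1) :=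
    map_injective (fun p q h => by
      simp only [Prod.mk.injEq, add_left_inj] at h
      exact Prod.ext h.1 h.2)
  have hfB : Function.Injective fB := by
    refine (injective_iff_map_eq_one _).2 fun w h => Subtype.ext (hshift ?_)
    rw [OneMemClass.coe_one, _root_.map_one]
    refine hB _ ?_ ((hπ _).1 h)
    exact map_mem_supported (fun p hp => by
      have := hp.1; change 0 < p.2 + 1; omega) w.2
  let φ : fA.range ≃* fB.range :=
    (MonoidHom.ofInjective hfA).symm.trans (MonoidHom.ofInjective hfB)
  have hφ : ∀ w : supported S, (φ ⟨fA w, w, rfl⟩ : G) = fB w := by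
    intro w
    have : (MonoidHom.ofInjective hfA).symm ⟨fA w, w, rfl⟩ = w := by
      rw [MulEquiv.symm_apply_eq]; rfl
    simp only [φ, MulEquiv.trans_apply, this]
    rfl
  let Ψ : FreeGroup α →* HNNExtension G fA.range fB.range φ :=
    lift fun y => if y = x then HNNExtension.t else HNNExtension.of (π (of (y, 0)))
  have hlevel : ∀ y ≠ x, ∀ i : ℕ, (i : ℤ) ≤ M →
      Ψ (ofLevels x (of (y, (i : ℤ)))) = HNNExtension.of (π (of (y, (i : ℤ)))) := by
    intro y hy i
    induction i with
    | zero => intro _; simp [ofLevels, Ψ, hy]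
    | succ i ih =>
      intro hi
      push_cast at hi ⊢
      have hmem : of (y, (i : ℤ)) ∈ supported S :=
        of_mem_supported ⟨by simp, by simp only; omega⟩
      have h1 := HNNExtension.equiv_eq_conj (φ := φ) ⟨fA ⟨_, hmem⟩, _, rfl⟩
      rw [hφ] at h1
      have h2 : fB ⟨_, hmem⟩ = π (of (y, (i : ℤ) + 1)) := by simp [fB, levelShift]
      have h3 : fA ⟨_, hmem⟩ = π (of (y, (i : ℤ))) := rfl
      rw [h2] at h1
      rw [h1]
      simp only [h3]
      rw [← ih (by omega)]
      have h4 : of (y, (i : ℤ) + 1) = levelShift 1 (of (y, (i : ℤ))) := by simp [levelShift]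
      have h5 : Ψ (of x) = HNNExtension.t := by simp [Ψ]
      rw [h4, ofLevels_levelShift, zpow_one, _root_.map_mul, _root_.map_mul, _root_.map_inv, h5]
  have hΨ : ∀ w ∈ supported {p : α × ℤ | p.1 ≠ x ∧ 0 ≤ p.2 ∧ p.2 ≤ M},
      Ψ (ofLevels x w) = HNNExtension.of (π w) := by
    intro w hw
    refine eqOn_supported (f := Ψ.comp (ofLevels x)) (g := HNNExtension.of.comp π) ?_ hw
    rintro ⟨y, i⟩ ⟨hy, h0, hiM⟩
    lift i to ℕ using h0
    exact hlevel y hy i hiM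
  have h1 : Ψ (ofLevels x w) = 1 := by
    refine map_eq_one_of_mem_normalClosure Ψ ?_ hwr
    rw [hΨ r hr, (hπ r).2 (Subgroup.subset_normalClosure rfl), _root_.map_one]
  rw [hΨ w hw] at h1
  -- The base group embeds in its HNN extension, so triviality there descends to `G`.
  exact (hπ w).1 (HNNExtension.of_injective _ (h1.trans (_root_.map_one _).symm))

end Levels

/-- Magnus induction on the length of the cyclically reduced relator. Nonzero exponent sum in `x` is
settled by `p`-groups. Otherwise rewriting shortens the relator, and the induction hypothesis, with
a letter of the top or bottom level as omitted generator, supplies the two embeddings that the HNN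
extension needs. The alphabet varies because rewriting replaces `α` by `α × ℤ`. -/
theorem eq_one_of_mem_normalClosure_of_length : ∀ (n : ℕ) (α : Type) [DecidableEq α] (x : α)
    (r : FreeGroup α), (cyclicReduction r).length = n →
    (∀ w ∈ supported {x}ᶜ, ¬ IsConj r w) → ∀ w ∈ supported {x}ᶜ,
      w ∈ Subgroup.normalClosure {r} → w = 1 := by
  intro n
  induction n using Nat.strong_induction_on with
  | _ n ih =>
    intro α _ x r hn hx w hw hwr
    by_cases hr : exponentSum x r = 1
    swap
    · exact eq_one_of_exponentSum_ne_zero hr hw hwr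
    obtain ⟨L, M, hM, hL, hconj, hsupp, ⟨l₀, hl₀, hl₀0⟩, ⟨l₁, hl₁, hl₁M⟩, hlen⟩ :=
      exists_levels hr hx
    have key : ∀ l ∈ L, ∀ w ∈ supported {l.1}ᶜ, w ∈ Subgroup.normalClosure {mk L} → w = 1 := by
      intro l hl
      refine ih L.length (hn ▸ hlen) _ l.1 (mk L)
        (by rw [cyclicReduction_eq_of_isCyclicallyReduced hL]) fun w hw hc => ?_
      exact hL.mem_of_isConj_supported hw hc l hl rfl
    have h0 : map (fun y => (y, (0 : ℤ))) w ∈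
        supported {p : α × ℤ | p.1 ≠ x ∧ 0 ≤ p.2 ∧ p.2 ≤ M} :=
      map_mem_supported (fun y hy => show y ≠ x ∧ (0 : ℤ) ≤ 0 ∧ (0 : ℤ) ≤ M from
        ⟨hy, le_rfl, by omega⟩) hw
    have h1 : map (fun y => (y, (0 : ℤ))) w ∈ Subgroup.normalClosure {mk L} := by
      refine mem_normalClosure_of_ofLevels_mem (mk_mem_supported hsupp)
        (fun w hw => key l₁ hl₁ w (supported_mono ?_ hw))
        (fun w hw => key l₀ hl₀ w (supported_mono ?_ hw)) h0 ?_
      · rintro p hp rfl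
        exact absurd hp (by simp [hl₁M])
      · rintro p hp rfl
        exact absurd hp (by simp [hl₀0])
      · rwa [ofLevels_map_zero, normalClosure_singleton_eq_of_isConj hconj]
    -- At level `0` the word omits the top-level letter `l₁`, since `1 ≤ M`.
    have h2 : map (fun y => (y, (0 : ℤ))) w = 1 := by
      refine key l₁ hl₁ _ (map_mem_supported ?_ hw) h1
      rintro y - h
      have : (y, (0 : ℤ)) = l₁.1 := h
      rw [← this] at hl₁M
      simp only at hl₁M
      omega
    rw [← ofLevels_map_zero x w, h2, _root_.map_one]

/-- The **Freiheitssatz**: if the relator `r` is not conjugate to a word omitting the generator `x`,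
then no nontrivial word omitting `x` is a consequence of `r`. -/
theorem freiheitssatz {α : Type} {x : α} {r : FreeGroup α}
    (hx : ∀ w ∈ supported {x}ᶜ, ¬ IsConj r w) {w : FreeGroup α} (hw : w ∈ supported {x}ᶜ)
    (hwr : w ∈ Subgroup.normalClosure {r}) : w = 1 := by
  classical
  exact eq_one_of_mem_normalClosure_of_length _ α x r rfl hx w hw hwr

/-! ### Relators that have the basic commutator as a consequence -/

theorem exists_zpow_of_mem_supported_singleton {α : Type*} {y : α} {w : FreeGroup α}
    (hw : w ∈ supported {y}) : ∃ k : ℤ, w = of y ^ k := by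
  rw [supported, Set.image_singleton, Subgroup.mem_closure_singleton] at hw
  obtain ⟨k, hk⟩ := hw
  exact ⟨k, hk.symm⟩

theorem natAbs_eq_one_of_of_mem_normalClosure {α : Type*} {y : α} {k : ℤ}
    (h : of y ∈ Subgroup.normalClosure {of y ^ k}) : k.natAbs = 1 := by
  let f : FreeGroup α →* Multiplicative (ZMod k.natAbs) := lift fun _ => Multiplicative.ofAdd 1
  have h1 : f (of y) = 1 := by
    refine map_eq_one_of_mem_normalClosure f ?_ h
    have : (k : ZMod k.natAbs) = 0 := by
      rw [ZMod.intCast_zmod_eq_zero_iff_dvd]; simp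
    simp [f, ← ofAdd_zsmul, this]
  have h2 : (1 : ZMod k.natAbs) = 0 := by simpa [f] using h1
  rwa [← Nat.cast_one, ZMod.natCast_eq_zero_iff, Nat.dvd_one] at h2

/-- A relator in the commutator subgroup of the free group on `a`, `b` having `[a, b]` as a
consequence is conjugate to `[a, b]` or its inverse. -/
theorem isConj_commutator_of_mem_normalClosure {r : FreeGroup (Fin 2)}
    (h0 : exponentSum 0 r = 1) (h1 : exponentSum 1 r = 1)
    (hr : of 0 * of 1 * (of 0)⁻¹ * (of 1)⁻¹ ∈ Subgroup.normalClosure {r}) :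
    IsConj r (of 0 * of 1 * (of 0)⁻¹ * (of 1)⁻¹) ∨
      IsConj r (of 1 * of 0 * (of 1)⁻¹ * (of 0)⁻¹) := by
  have hfin0 : ({0}ᶜ : Set (Fin 2)) = {1} := by ext i; fin_cases i <;> simp
  have hfin1 : ({1}ᶜ : Set (Fin 2)) = {0} := by ext i; fin_cases i <;> simp
  -- A conjugate of `r` omitting `b` would be a power of `a` of exponent sum zero, forcing `r = 1`.
  have hx : ∀ w ∈ supported {1}ᶜ, ¬ IsConj r w := by
    intro w hw hc
    rw [hfin1] at hw
    obtain ⟨k, rfl⟩ := exists_zpow_of_mem_supported_singleton hw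
    have hk : k = 0 := by
      have := exponentSum_eq_of_isConj 0 hc
      rw [h0, map_zpow] at this
      exact (by simpa [exponentSum, ← ofAdd_zsmul] using this : 1 = Multiplicative.ofAdd k).symm
    subst hk
    rw [zpow_zero] at hc
    have hr1 : r = 1 := isConj_one_left.1 hc
    subst hr1
    rw [Subgroup.normalClosure_eq_bot_iff.2 (by simp), Subgroup.mem_bot] at hr
    exact absurd hr (by decide)
  obtain ⟨L, M, hM, hL, hconj, hsupp, ⟨l₀, hl₀, hl₀0⟩, ⟨l₁, hl₁, hl₁M⟩, -⟩ :=
    exists_levels h1 hx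
  have key : ∀ l ∈ L, ∀ w ∈ supported {l.1}ᶜ, w ∈ Subgroup.normalClosure {mk L} → w = 1 := by
    intro l hl w hw
    exact freiheitssatz (fun w hw hc => hL.mem_of_isConj_supported hw hc l hl rfl) hw
  -- With `a_i = b^i a b^{-i}`, the commutator `[a, b]` is `a_0 a_1⁻¹`.
  set c : FreeGroup (Fin 2 × ℤ) := of (0, 0) * (of (0, 1))⁻¹ with hc
  have hιc : ofLevels 1 c = of 0 * of 1 * (of 0)⁻¹ * (of 1)⁻¹ := by
    simp [hc, ofLevels, mul_assoc]
  have hcr : c ∈ Subgroup.normalClosure {mk L} := by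
    refine mem_normalClosure_of_ofLevels_mem (mk_mem_supported hsupp)
      (fun w hw => key l₁ hl₁ w (supported_mono ?_ hw))
      (fun w hw => key l₀ hl₀ w (supported_mono ?_ hw))
      (mul_mem (of_mem_supported ?_) (inv_mem (of_mem_supported ?_))) ?_
    · rintro p hp rfl
      exact absurd hp (by simp [hl₁M])
    · rintro p hp rfl
      exact absurd hp (by simp [hl₀0])
    · exact ⟨by decide, le_rfl, by simp only; omega⟩
    · exact ⟨by decide, by simp, hM⟩
    · rwa [hιc, normalClosure_singleton_eq_of_isConj hconj]
  have hc1 : c ≠ 1 := by rw [hc]; decide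
  -- For `M ≥ 2` the word `c` would omit the letter `l₁` of level `M`, and the Freiheitssatz would
  -- make it trivial.
  have hM1 : M = 1 := by
    by_contra hne
    refine hc1 (key l₁ hl₁ c (mul_mem (of_mem_supported ?_) (inv_mem (of_mem_supported ?_))) hcr)
    · intro (h : _ = l₁.1)
      rw [← h] at hl₁M
      simp only at hl₁M
      omega
    · intro (h : _ = l₁.1)
      rw [← h] at hl₁M
      exact hne hl₁M.symm
  subst hM1
  -- pass to the free basis `X = (0, 1)`, `Y = c` of the subgroup generated by the two levels
  let κ : FreeGroup (Fin 2 × ℤ) →* FreeGroup (Fin 2) :=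
    lift fun p => if p.2 = 0 then of 1 * of 0 else of 0
  let ν : FreeGroup (Fin 2) →* FreeGroup (Fin 2 × ℤ) := lift ![of (0, 1), c]
  have hνκ : ν (κ (mk L)) = mk L := by
    refine eqOn_supported (f := ν.comp κ) (g := MonoidHom.id _)
      (S := {p | p.1 ≠ 1 ∧ 0 ≤ p.2 ∧ p.2 ≤ 1}) ?_ (mk_mem_supported hsupp)
    rintro ⟨y, i⟩ ⟨hy, hi0, hi1⟩
    have hy0 : y = 0 := by
      simp only at hy
      omega
    subst hy0
    simp only at hi0 hi1
    obtain rfl | rfl : i = 0 ∨ i = 1 := by omega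
    · simp [ν, κ, hc]
    · simp [ν, κ]
  have hκc : κ c = of 1 := by simp [κ, hc]
  have hYq : of 1 ∈ Subgroup.normalClosure {κ (mk L)} := by
    rw [← hκc]
    have h2 : Subgroup.normalClosure {mk L} ≤ (Subgroup.normalClosure {κ (mk L)}).comap κ :=
      Subgroup.normalClosure_le_normal (Set.singleton_subset_iff.2
        (Subgroup.subset_normalClosure (Set.mem_singleton (κ (mk L)))))
    exact h2 hcr
  -- `Y` is a consequence of the rewritten relator and omits `X`, so by the Freiheitssatz the
  -- relator is conjugate to a power of `Y`. Since `Y` is a consequence of that power, the exponent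
  -- is `±1`.
  obtain ⟨w, hw, hqw⟩ : ∃ w ∈ supported {0}ᶜ, IsConj (κ (mk L)) w := by
    by_contra! h
    exact of_ne_one _ (freiheitssatz h (of_mem_supported (by simp)) hYq)
  rw [hfin0] at hw
  obtain ⟨k, rfl⟩ := exists_zpow_of_mem_supported_singleton hw
  rw [normalClosure_singleton_eq_of_isConj hqw] at hYq
  have hk := natAbs_eq_one_of_of_mem_normalClosure hYq
  have hrc : IsConj r ((of 0 * of 1 * (of 0)⁻¹ * (of 1)⁻¹) ^ k) := by
    have h2 := (ofLevels 1).map_isConj (ν.map_isConj hqw)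
    rw [hνκ, map_zpow, map_zpow] at h2
    have h3 : ν (of 1) = c := by simp [ν]
    rw [h3, hιc] at h2
    exact hconj.symm.trans h2
  obtain rfl | rfl : k = 1 ∨ k = -1 := by omega
  · left; simpa using hrc
  · right
    have h4 : (of 0 * of 1 * (of 0)⁻¹ * (of 1)⁻¹ : FreeGroup (Fin 2)) ^ (-1 : ℤ) =
      of 1 * of 0 * (of 1)⁻¹ * (of 0)⁻¹ := by group
    rwa [h4] at hrc

end FreeGroup

/-! ### Crossed homomorphisms and the Fox derivative into Laurent polynomials -/

namespace FreeGroup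

open LaurentPolynomial

theorem exists_crossedHom {ι E : Type*} [AddCommGroup E] (τ : FreeGroup ι →* AddMonoid.End E)
    (e : ι → E) : ∃ D : FreeGroup ι → E, (∀ i, D (of i) = e i) ∧
      ∀ g h, D (g * h) = D g + τ g (D h) := by
  have hmul : ∀ g h m, τ (g * h) m = τ g (τ h m) := fun g h m => by
    rw [_root_.map_mul]; rfl
  have hone : ∀ m, τ 1 m = m := fun m => by rw [_root_.map_one]; rfl
  have hτ : ∀ g m, τ g⁻¹ (τ g m) = m := fun g m => by rw [← hmul, inv_mul_cancel, hone]
  have hτ' : ∀ g m, τ g (τ g⁻¹ m) = m := fun g m => by rw [← hmul, mul_inv_cancel, hone]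
  -- Crossed homomorphisms are affine actions with linear part `τ`. The value at `w` is the image of
  -- the origin.
  let P : FreeGroup ι →* Equiv.Perm E := lift fun i =>
    { toFun := fun m => τ (of i) m + e i
      invFun := fun m => τ (of i)⁻¹ (m - e i)
      left_inv := fun m => by simp only [add_sub_cancel_right, hτ]
      right_inv := fun m => by simp only [hτ', sub_add_cancel] }
  have hof : ∀ i m, P (of i) m = τ (of i) m + e i := fun i m => by simp [P]
  have hinv : ∀ i m, (P (of i))⁻¹ m = τ (of i)⁻¹ (m - e i) := fun i m => by
    rw [Equiv.Perm.inv_eq_iff_eq, hof, hτ', sub_add_cancel]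
  have hP : ∀ w m, P w m = τ w m + P w 0 := by
    intro w
    induction w using FreeGroup.induction_on with
    | C1 => intro m; simp
    | of i => intro m; simp [hof]
    | inv_of i _ => intro m; simp [hinv, sub_eq_add_neg]
    | mul v w hv hw =>
      intro m
      rw [_root_.map_mul, Equiv.Perm.mul_apply, Equiv.Perm.mul_apply, hv, hw, hv (P w 0),
        hmul, map_add, add_assoc]
  refine ⟨fun w => P w 0, fun i => by simp [hof], fun g h => ?_⟩
  simp only [_root_.map_mul, Equiv.Perm.mul_apply]
  rw [hP, add_comm]

/-- The exponent sum of the second generator, as an integer. -/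
def texp (w : FreeGroup (Fin 2)) : ℤ := (exponentSum 1 w).toAdd

theorem texp_mul (v w : FreeGroup (Fin 2)) : texp (v * w) = texp v + texp w := by
  simp [texp]

theorem texp_one : texp 1 = 0 := by simp [texp]

theorem texp_inv (w : FreeGroup (Fin 2)) : texp w⁻¹ = -texp w := by simp [texp]

theorem texp_of_zero : texp (of 0) = 0 := by simp [texp, exponentSum]

theorem texp_of_one : texp (of 1) = 1 := by simp [texp, exponentSum]

theorem exists_foxDerivative : ∃ D : FreeGroup (Fin 2) → ℤ[T;T⁻¹], D (of 0) = 1 ∧ D (of 1) = 0 ∧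
    ∀ v w, D (v * w) = D v + T (texp v) * D w := by
  let τ : FreeGroup (Fin 2) →* AddMonoid.End ℤ[T;T⁻¹] :=
    { toFun := fun w => AddMonoidHom.mulLeft (T (texp w))
      map_one' := DFunLike.ext _ _ fun f => by
        change T (texp 1) * f = f
        rw [texp_one, T_zero, one_mul]
      map_mul' := fun v w => DFunLike.ext _ _ fun f => by
        change T (texp (v * w)) * f = T (texp v) * (T (texp w) * f)
        rw [texp_mul, T_add, mul_assoc] }
  obtain ⟨D, h1, h2⟩ := exists_crossedHom τ ![1, 0]
  exact ⟨D, h1 0, h1 1, h2⟩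

/-- The Fox derivative with respect to the first generator, evaluated in the group ring of the
infinite cyclic quotient in which the first generator becomes trivial. -/
noncomputable def foxD : FreeGroup (Fin 2) → ℤ[T;T⁻¹] := exists_foxDerivative.choose

theorem foxD_of_zero : foxD (of 0) = 1 := exists_foxDerivative.choose_spec.1

theorem foxD_of_one : foxD (of 1) = 0 := exists_foxDerivative.choose_spec.2.1

theorem foxD_mul (v w : FreeGroup (Fin 2)) : foxD (v * w) = foxD v + T (texp v) * foxD w :=
  exists_foxDerivative.choose_spec.2.2 v w

theorem foxD_one : foxD 1 = 0 := by
  have := foxD_mul 1 1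
  rw [mul_one, texp_one, T_zero, one_mul] at this
  simpa using this

theorem foxD_inv (w : FreeGroup (Fin 2)) : foxD w⁻¹ = -(T (-texp w) * foxD w) := by
  have := foxD_mul w⁻¹ w
  rw [inv_mul_cancel, foxD_one, texp_inv] at this
  exact eq_neg_of_add_eq_zero_left this.symm

theorem foxD_zpow_of_one (k : ℤ) : foxD (of 1 ^ k) = 0 := by
  have hn : ∀ n : ℕ, foxD (of 1 ^ n) = 0 := by
    intro n
    induction n with
    | zero => rw [pow_zero, foxD_one]
    | succ n ih => rw [pow_succ, foxD_mul, ih, foxD_of_one, mul_zero, add_zero]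
  obtain ⟨n, rfl | rfl⟩ := k.eq_nat_or_neg
  · rw [zpow_natCast, hn]
  · rw [zpow_neg, zpow_natCast, foxD_inv, hn, mul_zero, neg_zero]

theorem texp_zpow_of_one (k : ℤ) : texp (of 1 ^ k) = k := by
  simp [texp, exponentSum, ← ofAdd_zsmul]

/-- The pair `(foxD, texp)` is the projection of the free group onto `ℤ ≀ ℤ`. Its surjectivity later
lets cocycle values be lifted to free group elements. -/
theorem exists_foxD_eq (f : ℤ[T;T⁻¹]) (k : ℤ) : ∃ w, foxD w = f ∧ texp w = k := by
  have h0 : ∃ w, foxD w = f ∧ texp w = 0 := by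
    induction f using LaurentPolynomial.induction_on' with
    | add f g hf hg =>
      obtain ⟨v, hv, hv'⟩ := hf
      obtain ⟨w, hw, hw'⟩ := hg
      exact ⟨v * w, by rw [foxD_mul, hv, hw, hv', T_zero, one_mul], by rw [texp_mul, hv', hw']; rfl⟩
    | C_mul_T n a =>
      have h1 : ∀ m : ℕ, foxD (of 0 ^ m) = m ∧ texp (of 0 ^ m) = 0 := by
        intro m
        induction m with
        | zero => simp [foxD_one, texp_one]
        | succ m ih =>
          rw [pow_succ, foxD_mul, texp_mul, ih.1, ih.2, foxD_of_zero, texp_of_zero]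
          simp
      have h2 : ∃ w, foxD w = (a : ℤ[T;T⁻¹]) ∧ texp w = 0 := by
        obtain ⟨m, rfl | rfl⟩ := a.eq_nat_or_neg
        · exact ⟨of 0 ^ m, by simpa using (h1 m).1, (h1 m).2⟩
        · exact ⟨(of 0 ^ m)⁻¹, by rw [foxD_inv, (h1 m).1, (h1 m).2]; simp,
            by rw [texp_inv, (h1 m).2]; rfl⟩
      obtain ⟨w, hw, hw'⟩ := h2
      refine ⟨of 1 ^ n * w * (of 1 ^ n)⁻¹, ?_, ?_⟩
      · rw [foxD_mul, foxD_mul, foxD_inv, foxD_zpow_of_one, hw, texp_zpow_of_one]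
        simp
      · rw [texp_mul, texp_mul, texp_inv, hw']
        ring
  obtain ⟨w, hw, hw'⟩ := h0
  exact ⟨w * of 1 ^ k, by rw [foxD_mul, foxD_zpow_of_one, hw, mul_zero, add_zero],
    by rw [texp_mul, hw', texp_zpow_of_one, zero_add]⟩

theorem mul_ne_mul_of_foxD {v w : FreeGroup (Fin 2)} (hv : texp v = 0) (hv' : foxD v ≠ 0)
    (hw : texp w ≠ 0) : v * w ≠ w * v := by
  intro h
  have h1 := congrArg foxD h
  rw [foxD_mul, foxD_mul, hv, T_zero, one_mul] at h1
  have h2 : (1 - T (texp w)) * foxD v = 0 := by linear_combination h1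
  rcases mul_eq_zero.1 h2 with h3 | h3
  · have := congrArg (fun f : ℤ[T;T⁻¹] => f.coeff 0) h3
    rw [← T_zero] at this
    simp [hw] at this
  · exact hv' h3

theorem exists_laurentPolynomial_lift {B : Type*} [CommGroup B] (c : ℤ → B) :
    ∃ θ : ℤ[T;T⁻¹] → B, θ 0 = 1 ∧ (∀ f g, θ (f + g) = θ f * θ g) ∧
      ∀ (n : ℤ) (a : ℤ), θ (C a * T n) = c n ^ a := by
  let θ : ℤ[T;T⁻¹] →+ Additive B :=
    (Finsupp.liftAddHom fun i => zmultiplesHom (Additive B) (Additive.ofMul (c i))).comp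
      AddMonoidAlgebra.coeffAddEquiv.toAddMonoidHom
  refine ⟨fun f => (θ f).toMul, by simp, fun f g => by simp, fun n a => ?_⟩
  rw [← single_eq_C_mul_T]
  change (Finsupp.liftAddHom (fun i => zmultiplesHom (Additive B) (Additive.ofMul (c i)))
    (Finsupp.single n a)).toMul = c n ^ a
  rw [Finsupp.liftAddHom_apply_single]
  rfl

/-- Commutativity of the conjugates `t^i c t^{-i}` is a set of defining relations for `ℤ ≀ ℤ`, so
`π` depends only on `foxD` and `texp`. The formula `main` exhibits this dependence. -/
theorem map_eq_one_of_foxD_eq_zero {Q : Type*} [Group Q] (π : FreeGroup (Fin 2) →* Q)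
    (hπ : ∀ i j : ℤ, Commute (π (of 1 ^ i * of 0 * (of 1 ^ i)⁻¹))
      (π (of 1 ^ j * of 0 * (of 1 ^ j)⁻¹))) {w : FreeGroup (Fin 2)} (hw : texp w = 0)
    (hw' : foxD w = 0) : π w = 1 := by
  let c : ℤ → Q := fun i => π (of 1 ^ i * of 0 * (of 1 ^ i)⁻¹)
  let A := Subgroup.closure (Set.range c)
  have hA : IsMulCommutative A := Subgroup.isMulCommutative_closure (by
    rintro _ ⟨i, rfl⟩ _ ⟨j, rfl⟩
    exact hπ i j)
  let _ : CommGroup A :=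
    { (inferInstance : Group A) with mul_comm := fun x y => hA.is_comm.comm x y }
  let c' : ℤ → A := fun i => ⟨c i, Subgroup.subset_closure ⟨i, rfl⟩⟩
  obtain ⟨θ, hθ0, hθadd, hθT⟩ := exists_laurentPolynomial_lift c'
  let Θ : ℤ[T;T⁻¹] → Q := fun f => (θ f : Q)
  have hΘadd : ∀ f g, Θ (f + g) = Θ f * Θ g := fun f g => congrArg Subtype.val (hθadd f g)
  have hΘ0 : Θ 0 = 1 := congrArg Subtype.val hθ0
  have hΘT : ∀ n a, Θ (C a * T n) = c n ^ a := fun n a => congrArg Subtype.val (hθT n a)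
  have hconj : ∀ k f, Θ (T k * f) = π (of 1) ^ k * Θ f * (π (of 1) ^ k)⁻¹ := by
    intro k f
    induction f using LaurentPolynomial.induction_on' with
    | add f g hf hg => rw [mul_add, hΘadd, hf, hg, hΘadd]; group
    | C_mul_T n a =>
      have : (T k * (C a * T n) : ℤ[T;T⁻¹]) = C a * T (k + n) := by
        rw [T_add, mul_left_comm]
      rw [this, hΘT, hΘT, ← conj_zpow]
      congr 1
      simp only [c, _root_.map_mul, map_zpow, _root_.map_inv, zpow_add]
      group
  have main : ∀ v, π v = Θ (foxD v) * π (of 1) ^ texp v := by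
    intro v
    induction v using FreeGroup.induction_on with
    | C1 => simp [foxD_one, texp_one, hΘ0]
    | of i =>
      fin_cases i
      · have h1 : foxD (of 0) = C 1 * T 0 := by rw [foxD_of_zero]; simp
        simp only [Fin.zero_eta, Fin.isValue, texp_of_zero, h1, hΘT]
        simp [c]
      · simp [foxD_of_one, texp_of_one, hΘ0]
    | inv_of i h =>
      have h2 : Θ (foxD (of i)⁻¹) * π (of 1) ^ texp (of i)⁻¹ * π (of i) = 1 := by
        rw [h]
        have h3 := hΘadd (foxD (of i)⁻¹) (T (texp (of i)⁻¹) * foxD (of i))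
        rw [← foxD_mul, inv_mul_cancel, foxD_one, hΘ0, hconj] at h3
        rw [h3, texp_inv]
        group
      rw [_root_.map_inv]
      exact (eq_inv_of_mul_eq_one_left h2).symm
    | mul v w hv hw =>
      rw [_root_.map_mul, hv, hw, foxD_mul, hΘadd, hconj, texp_mul, zpow_add]
      group
  rw [main, hw, hw', hΘ0, zpow_zero, mul_one]

/-! ### Wreath products of the free group with finite cyclic groups, approximating `ℤ ≀ ℤ` -/

/-- The homomorphism from the free group on `c`, `t` to the wreath product of itself with a finite
cyclic group that spreads the conjugates of `c` by powers of `t` over the coordinates. -/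
noncomputable def cyclicWreath (N : ℕ) :
    FreeGroup (Fin 2) →* FreeGroup (Fin 2) ≀ᵣ Multiplicative (ZMod N) := by
  classical
  exact lift ![⟨Pi.mulSingle 1 (of 0), 1⟩, ⟨fun _ => of 1, Multiplicative.ofAdd 1⟩]

theorem cyclicWreath_zpow_of_one (N : ℕ) (k : ℤ) :
    cyclicWreath N (of 1 ^ k) = ⟨fun _ => of 1 ^ k, Multiplicative.ofAdd (k : ZMod N)⟩ := by
  let f : Multiplicative ℤ →* FreeGroup (Fin 2) ≀ᵣ Multiplicative (ZMod N) :=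
    { toFun := fun k => ⟨fun _ => of 1 ^ k.toAdd, Multiplicative.ofAdd (k.toAdd : ZMod N)⟩
      map_one' := by ext <;> simp
      map_mul' := fun k l => by ext <;> simp [zpow_add] }
  have h1 : cyclicWreath N (of 1) = f (Multiplicative.ofAdd 1) := by
    simp [cyclicWreath, f]
  rw [map_zpow, h1, ← map_zpow, ← ofAdd_zsmul]
  simp [f]

theorem cyclicWreath_conj (N : ℕ) (k : ℤ) :
    (cyclicWreath N (of 1 ^ k * of 0 * (of 1 ^ k)⁻¹)).right = 1 ∧
    ∀ j, j ≠ Multiplicative.ofAdd (k : ZMod N) →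
      (cyclicWreath N (of 1 ^ k * of 0 * (of 1 ^ k)⁻¹)).left j = 1 := by
  have h0 : cyclicWreath N (of 0) = ⟨Pi.mulSingle 1 (of 0), 1⟩ := by
    classical
    simp [cyclicWreath]
  rw [_root_.map_mul, _root_.map_mul, _root_.map_inv, cyclicWreath_zpow_of_one, h0]
  refine ⟨by simp, fun j hj => ?_⟩
  have : (Multiplicative.ofAdd (k : ZMod N))⁻¹ * j ≠ 1 := by
    rwa [ne_eq, inv_mul_eq_one, eq_comm]
  simp [Pi.mulSingle_eq_of_ne this]

/-- The two conjugates lie in the base group and are supported on different coordinates. -/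
theorem cyclicWreath_commute {N : ℕ} {i j : ℤ} (h : (i : ZMod N) ≠ j) :
    Commute (cyclicWreath N (of 1 ^ i * of 0 * (of 1 ^ i)⁻¹))
      (cyclicWreath N (of 1 ^ j * of 0 * (of 1 ^ j)⁻¹)) := by
  obtain ⟨hi, hi'⟩ := cyclicWreath_conj N i
  obtain ⟨hj, hj'⟩ := cyclicWreath_conj N j
  set v := cyclicWreath N (of 1 ^ i * of 0 * (of 1 ^ i)⁻¹)
  set w := cyclicWreath N (of 1 ^ j * of 0 * (of 1 ^ j)⁻¹)
  refine RegularWreathProduct.ext ?_ (by simp [hi, hj])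
  ext1 k
  simp only [RegularWreathProduct.mul_left, Pi.mul_apply, hi, hj, inv_one, one_mul]
  by_cases hk : k = Multiplicative.ofAdd (i : ZMod N)
  · rw [hj' k (by rw [hk]; exact fun h' => h (Multiplicative.ofAdd.injective h'))]
    simp
  · rw [hi' k hk]
    simp

/-- The normal subgroup of elements killed by `cyclicWreath N` for all large `N`. -/
def eventualKernel : Subgroup (FreeGroup (Fin 2)) where
  carrier := {w | ∀ᶠ N in Filter.atTop, cyclicWreath N w = 1}
  one_mem' := Filter.Eventually.of_forall fun N => _root_.map_one _
  mul_mem' := fun {v w} hv hw => by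
    filter_upwards [hv, hw] with N h1 h2
    rw [_root_.map_mul, h1, h2, one_mul]
  inv_mem' := fun {v} hv => by
    filter_upwards [hv] with N h1
    rw [_root_.map_inv, h1, inv_one]

instance : eventualKernel.Normal where
  conj_mem v hv g := by
    filter_upwards [hv] with N h1
    rw [_root_.map_mul, _root_.map_mul, h1, _root_.map_inv, mul_one, mul_inv_cancel]

/-- Modulo `eventualKernel` all conjugates of `c` by powers of `t` commute: those with exponents `i
≠ j` commute under `cyclicWreath N` once `N > |i - j|`. -/
theorem eventually_cyclicWreath_eq_one {w : FreeGroup (Fin 2)} (hw : texp w = 0)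
    (hw' : foxD w = 0) : ∀ᶠ N in Filter.atTop, cyclicWreath N w = 1 := by
  have h := map_eq_one_of_foxD_eq_zero (QuotientGroup.mk' eventualKernel) (fun i j => ?_) hw hw'
  · exact (QuotientGroup.eq_one_iff w).1 h
  · by_cases hij : i = j
    · rw [hij]
    rw [← commutatorElement_eq_one_iff_commute, ← map_commutatorElement]
    refine (QuotientGroup.eq_one_iff _).2 ?_
    filter_upwards [Filter.eventually_gt_atTop (i - j).natAbs] with N hN
    rw [map_commutatorElement, commutatorElement_eq_one_iff_commute]
    refine cyclicWreath_commute fun h' => ?_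
    rw [← sub_eq_zero, ← Int.cast_sub, ZMod.intCast_zmod_eq_zero_iff_dvd] at h'
    have := Nat.le_of_dvd (Int.natAbs_pos.2 (sub_ne_zero.2 hij)) (Int.natCast_dvd.1 h')
    omega

/-- The part of a Laurent polynomial supported on a residue class. -/
noncomputable def residuePart (N : ℕ) (j : ZMod N) : ℤ[T;T⁻¹] →+ ℤ[T;T⁻¹] :=
  AddMonoidAlgebra.coeffAddEquiv.symm.toAddMonoidHom.comp
    ((Finsupp.filterAddHom fun i : ℤ => (i : ZMod N) = j).comp
      AddMonoidAlgebra.coeffAddEquiv.toAddMonoidHom)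

theorem residuePart_coeff (N : ℕ) (j : ZMod N) (f : ℤ[T;T⁻¹]) (i : ℤ) :
    (residuePart N j f).coeff i = if (i : ZMod N) = j then f.coeff i else 0 := by
  classical
  exact Finsupp.filter_apply _ _ _

theorem T_mul_coeff (k : ℤ) (f : ℤ[T;T⁻¹]) (i : ℤ) : (T k * f).coeff i = f.coeff (i - k) := by
  have := AddMonoidAlgebra.coeff_single_mul_eq_mul_coeff (R := ℤ) (x := f) (r := 1) (m := k)
    (m₁ := i) (i - k) (fun m _ => by omega)
  rw [one_mul] at this
  exact this

theorem residuePart_T_mul (N : ℕ) (j : ZMod N) (k : ℤ) (f : ℤ[T;T⁻¹]) :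
    residuePart N j (T k * f) = T k * residuePart N (j - k) f := by
  refine LaurentPolynomial.ext fun i => ?_
  rw [residuePart_coeff, T_mul_coeff, T_mul_coeff, residuePart_coeff]
  congr 1
  rw [Int.cast_sub, sub_left_inj]

theorem exists_residuePart_ne_zero (N : ℕ) {f : ℤ[T;T⁻¹]} (hf : f ≠ 0) :
    ∃ j, residuePart N j f ≠ 0 := by
  by_contra! h
  refine hf (LaurentPolynomial.ext fun i => ?_)
  have := residuePart_coeff N i f i
  rw [h, if_pos rfl] at this
  exact this.symm

/-- The coordinates split the Fox derivative by residue classes, so a nonzero derivative survives in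
some coordinate. -/
theorem cyclicWreath_spec (N : ℕ) (w : FreeGroup (Fin 2)) :
    (cyclicWreath N w).right = Multiplicative.ofAdd (texp w : ZMod N) ∧
    ∀ j : ZMod N, texp ((cyclicWreath N w).left (Multiplicative.ofAdd j)) = texp w ∧
      foxD ((cyclicWreath N w).left (Multiplicative.ofAdd j)) = residuePart N j (foxD w) := by
  induction w using FreeGroup.induction_on with
  | C1 => simp [texp_one, foxD_one]
  | of i =>
    fin_cases i
    · have h0 : cyclicWreath N (of 0) = ⟨Pi.mulSingle 1 (of 0), 1⟩ := by
        classical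
        simp [cyclicWreath]
      simp only [Fin.zero_eta, h0, texp_of_zero, foxD_of_zero]
      refine ⟨by simp, fun j => ?_⟩
      by_cases hj : j = 0
      · subst hj
        have : (Pi.mulSingle 1 (of 0) : Multiplicative (ZMod N) → FreeGroup (Fin 2))
          (Multiplicative.ofAdd 0) = of 0 := Pi.mulSingle_eq_same _ _
        rw [this, texp_of_zero, foxD_of_zero]
        refine ⟨rfl, LaurentPolynomial.ext fun i => ?_⟩
        rw [residuePart_coeff, ← T_zero, T_apply]
        by_cases hi : 0 = i
        · subst hi; simp
        · simp [hi]
      · have : (Pi.mulSingle 1 (of 0) : Multiplicative (ZMod N) → FreeGroup (Fin 2))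
          (Multiplicative.ofAdd j) = 1 := Pi.mulSingle_eq_of_ne (by simpa using hj) _
        rw [this, texp_one, foxD_one]
        refine ⟨rfl, LaurentPolynomial.ext fun i => ?_⟩
        rw [residuePart_coeff, ← T_zero, T_apply]
        by_cases hi : 0 = i
        · subst hi; simp [eq_comm, hj]
        · simp [hi]
    · have h1 := cyclicWreath_zpow_of_one N 1
      rw [zpow_one] at h1
      simp [h1, texp_of_one, foxD_of_one]
  | inv_of i h =>
    obtain ⟨h1, h2⟩ := h
    rw [_root_.map_inv, texp_inv, foxD_inv]
    refine ⟨by simp [h1], fun j => ?_⟩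
    have h3 : (cyclicWreath N (of i))⁻¹.left (Multiplicative.ofAdd j) =
        ((cyclicWreath N (of i)).left (Multiplicative.ofAdd (texp (of i) + j)))⁻¹ := by
      simp [h1]
    rw [h3, texp_inv, foxD_inv, (h2 _).1, (h2 _).2, map_neg, residuePart_T_mul]
    refine ⟨rfl, ?_⟩
    congr 3
    rw [Int.cast_neg, sub_neg_eq_add, add_comm]
  | mul v w hv hw =>
    obtain ⟨hv1, hv2⟩ := hv
    obtain ⟨hw1, hw2⟩ := hw
    rw [_root_.map_mul, texp_mul, foxD_mul]
    refine ⟨by simp [hv1, hw1], fun j => ?_⟩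
    have h3 : (cyclicWreath N v * cyclicWreath N w).left (Multiplicative.ofAdd j) =
        (cyclicWreath N v).left (Multiplicative.ofAdd j) *
          (cyclicWreath N w).left (Multiplicative.ofAdd (j - texp v)) := by
      simp [hv1, sub_eq_neg_add]
    rw [h3, texp_mul, foxD_mul, (hv2 _).1, (hv2 _).2, (hw2 _).1, (hw2 _).2, map_add,
      residuePart_T_mul]
    exact ⟨rfl, rfl⟩

/-! ### Monomial representations on functions and dimension counts -/

section Twisted

variable {X K : Type*} [Field K] (σ : FreeGroup (Fin 2) →* Equiv.Perm X)

/-- The monomial representation on functions defined by a permutation action and a multiplicative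
cocycle. -/
def twistedRep (κ : FreeGroup (Fin 2) → X → K) (hκ1 : ∀ x, κ 1 x = 1)
    (hκ : ∀ g h x, κ (g * h) x = κ g x * κ h ((σ g)⁻¹ x)) :
    FreeGroup (Fin 2) →* Module.End K (X → K) where
  toFun g :=
    { toFun := fun f x => κ g x * f ((σ g)⁻¹ x)
      map_add' := fun f f' => by ext x; simp [mul_add]
      map_smul' := fun c f => by ext x; simp [mul_left_comm] }
  map_one' := by ext f x; simp [hκ1]
  map_mul' g h := LinearMap.ext fun f => funext fun x => by
    change κ (g * h) x * f ((σ (g * h))⁻¹ x) = κ g x * (κ h ((σ g)⁻¹ x) * _)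
    rw [hκ, _root_.map_mul, mul_inv_rev, mul_assoc]
    rfl

end Twisted

section Universal

variable {V K : Type*} [Field K] [AddCommGroup V] [Module K V]
  (ρ : FreeGroup (Fin 2) →* Module.End K V)

theorem exists_universal_crossedHom : ∃ D : FreeGroup (Fin 2) → (V × V →ₗ[K] V),
    D (of 0) = LinearMap.fst K V V ∧ D (of 1) = LinearMap.snd K V V ∧
      ∀ g h, D (g * h) = D g + ρ g ∘ₗ D h := by
  let τ : FreeGroup (Fin 2) →* AddMonoid.End (V × V →ₗ[K] V) :=
    { toFun := fun g =>
        { toFun := fun D => ρ g ∘ₗ D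
          map_zero' := LinearMap.comp_zero _
          map_add' := fun D D' => LinearMap.comp_add _ _ _ }
      map_one' := DFunLike.ext _ _ fun D => by
        change ρ 1 ∘ₗ D = D
        rw [_root_.map_one]; rfl
      map_mul' := fun g h => DFunLike.ext _ _ fun D => by
        change ρ (g * h) ∘ₗ D = ρ g ∘ₗ (ρ h ∘ₗ D)
        rw [_root_.map_mul]; rfl }
  obtain ⟨D, h1, h2⟩ := exists_crossedHom τ ![LinearMap.fst K V V, LinearMap.snd K V V]
  exact ⟨D, h1 0, h1 1, h2⟩

/-- The universal crossed homomorphism with values in a representation, as a function of its values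
on the two generators. -/
noncomputable def crossedHom : FreeGroup (Fin 2) → (V × V →ₗ[K] V) :=
  (exists_universal_crossedHom ρ).choose

theorem crossedHom_of_zero (p : V × V) : crossedHom ρ (of 0) p = p.1 := by
  rw [crossedHom, (exists_universal_crossedHom ρ).choose_spec.1]; rfl

theorem crossedHom_of_one (p : V × V) : crossedHom ρ (of 1) p = p.2 := by
  rw [crossedHom, (exists_universal_crossedHom ρ).choose_spec.2.1]; rfl

theorem crossedHom_mul (g h : FreeGroup (Fin 2)) (p : V × V) :
    crossedHom ρ (g * h) p = crossedHom ρ g p + ρ g (crossedHom ρ h p) := by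
  rw [crossedHom, (exists_universal_crossedHom ρ).choose_spec.2.2]; rfl

theorem crossedHom_one (p : V × V) : crossedHom ρ 1 p = 0 := by
  have := crossedHom_mul ρ 1 1 p
  rw [mul_one, _root_.map_one] at this
  simpa using this

theorem crossedHom_inv (g : FreeGroup (Fin 2)) (p : V × V) :
    crossedHom ρ g⁻¹ p = -ρ g⁻¹ (crossedHom ρ g p) := by
  have := crossedHom_mul ρ g⁻¹ g p
  rw [inv_mul_cancel, crossedHom_one] at this
  exact eq_neg_of_add_eq_zero_left this.symm

theorem crossedHom_commutator {u v : FreeGroup (Fin 2)} (hr : ρ (u * v * u⁻¹ * v⁻¹) = 1)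
    (p : V × V) : crossedHom ρ (u * v * u⁻¹ * v⁻¹) p =
      crossedHom ρ u p + ρ u (crossedHom ρ v p) - (crossedHom ρ v p + ρ v (crossedHom ρ u p)) := by
  have h1 : u * v * u⁻¹ * v⁻¹ * (v * u) = u * v := by group
  have h2 := crossedHom_mul ρ (u * v * u⁻¹ * v⁻¹) (v * u) p
  rw [h1, hr, crossedHom_mul, crossedHom_mul ρ v, Module.End.one_apply] at h2
  rw [h2, add_sub_cancel_right]

/-- The values on the generators of the principal crossed homomorphisms. -/
def principal : V →ₗ[K] V × V :=
  (ρ (of 0) - LinearMap.id).prod (ρ (of 1) - LinearMap.id)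

end Universal

section Dimension

variable {X K : Type*} [Field K] (σ : FreeGroup (Fin 2) →* Equiv.Perm X)
  (κ : FreeGroup (Fin 2) → X → K) (hκ1 : ∀ x, κ 1 x = 1)
  (hκ : ∀ g h x, κ (g * h) x = κ g x * κ h ((σ g)⁻¹ x))

theorem twistedRep_apply (g : FreeGroup (Fin 2)) (f : X → K) (x : X) :
    twistedRep σ κ hκ1 hκ g f x = κ g x * f ((σ g)⁻¹ x) := rfl

theorem twistedRep_eq_one {r : FreeGroup (Fin 2)} (hr : σ r = 1) (hκr : ∀ x, κ r x = 1) :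
    twistedRep σ κ hκ1 hκ r = 1 := by
  refine LinearMap.ext fun f => funext fun x => ?_
  rw [twistedRep_apply, hr, hκr]
  simp

/-- At a point where `u` and `v` both act trivially, the crossed homomorphism is additive on them,
so its value on `uv` agrees with that on `vu`. -/
theorem crossedHom_commutator_apply_fixed {u v : FreeGroup (Fin 2)} {x₀ : X}
    (hr : twistedRep σ κ hκ1 hκ (u * v * u⁻¹ * v⁻¹) = 1) (hu : σ u x₀ = x₀) (hv : σ v x₀ = x₀)
    (hκu : κ u x₀ = 1) (hκv : κ v x₀ = 1) (p : (X → K) × (X → K)) :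
    crossedHom (twistedRep σ κ hκ1 hκ) (u * v * u⁻¹ * v⁻¹) p x₀ = 0 := by
  have hu' : (σ u)⁻¹ x₀ = x₀ := by rw [Equiv.Perm.inv_eq_iff_eq, hu]
  have hv' : (σ v)⁻¹ x₀ = x₀ := by rw [Equiv.Perm.inv_eq_iff_eq, hv]
  rw [crossedHom_commutator _ hr]
  simp only [Pi.sub_apply, Pi.add_apply, twistedRep_apply, hu', hv', hκu, hκv]
  ring

/-- With `n = |X|`, there are `2n` parameters and at most `n - 1` independent conditions, since the
one at `x₀` is void. The solutions have dimension at least `n + 1`, the principal ones at most `n`.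
-/
theorem exists_crossedHom_not_principal [Fintype X] {u v : FreeGroup (Fin 2)} {x₀ : X}
    (hr : twistedRep σ κ hκ1 hκ (u * v * u⁻¹ * v⁻¹) = 1) (hu : σ u x₀ = x₀) (hv : σ v x₀ = x₀)
    (hκu : κ u x₀ = 1) (hκv : κ v x₀ = 1) :
    ∃ p, crossedHom (twistedRep σ κ hκ1 hκ) (u * v * u⁻¹ * v⁻¹) p = 0 ∧
      p ∉ LinearMap.range (principal (twistedRep σ κ hκ1 hκ)) := by
  classical
  by_contra! h
  set ρ := twistedRep σ κ hκ1 hκ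
  set Dr := crossedHom ρ (u * v * u⁻¹ * v⁻¹)
  have h1 : LinearMap.ker Dr ≤ LinearMap.range (principal ρ) := fun p hp => h p hp
  have h2 := Submodule.finrank_mono h1
  have h3 := LinearMap.finrank_range_add_finrank_ker Dr
  have h4 : LinearMap.range Dr ≤ LinearMap.ker (LinearMap.proj (R := K) (φ := fun _ : X => K) x₀) := by
    rintro _ ⟨p, rfl⟩
    exact crossedHom_commutator_apply_fixed σ κ hκ1 hκ hr hu hv hκu hκv p
  have h5 := Submodule.finrank_mono h4
  have h6 := LinearMap.finrank_range_add_finrank_ker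
    (LinearMap.proj (R := K) (φ := fun _ : X => K) x₀)
  rw [LinearMap.range_eq_top.2 (LinearMap.proj_surjective x₀), finrank_top] at h6
  have h7 := LinearMap.finrank_range_le (principal ρ)
  rw [Module.finrank_prod] at h3
  simp only [Module.finrank_self] at h6
  omega

/-- For the untwisted action the value on the relator also has coordinate sum zero. This pays for
one of the two extra conditions at `x₀`, leaving solutions of dimension at least `n = |X|`.
Constants are invariant, so principal ones have dimension at most `n - 1`. -/
theorem exists_crossedHom_not_principal_of_trivial [Fintype X] {u v : FreeGroup (Fin 2)} {x₀ x₁ : X}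
    (hx : x₁ ≠ x₀) (hone : ∀ g x, κ g x = 1)
    (hr : twistedRep σ κ hκ1 hκ (u * v * u⁻¹ * v⁻¹) = 1) (hu : σ u x₀ = x₀) (hv : σ v x₀ = x₀) :
    ∃ p, crossedHom (twistedRep σ κ hκ1 hκ) (u * v * u⁻¹ * v⁻¹) p = 0 ∧
      crossedHom (twistedRep σ κ hκ1 hκ) u p x₀ = 0 ∧
      crossedHom (twistedRep σ κ hκ1 hκ) v p x₀ = 0 ∧
      p ∉ LinearMap.range (principal (twistedRep σ κ hκ1 hκ)) := by
  classical
  by_contra! h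
  set ρ := twistedRep σ κ hκ1 hκ
  set Dr := crossedHom ρ (u * v * u⁻¹ * v⁻¹) with hDr
  let π₀ : (X → K) →ₗ[K] K := LinearMap.proj x₀
  let S : (X → K) →ₗ[K] K := ∑ x, LinearMap.proj x
  have hS : ∀ f, S f = ∑ x, f x := fun f => by simp [S]
  have hSρ : ∀ g f, S (ρ g f) = S f := by
    intro g f
    rw [hS, hS]
    simp only [ρ, twistedRep_apply, hone, one_mul]
    exact Equiv.sum_comp (σ g)⁻¹ f
  let Φ : (X → K) × (X → K) →ₗ[K] (X → K) × K × K :=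
    Dr.prod ((π₀ ∘ₗ crossedHom ρ u).prod (π₀ ∘ₗ crossedHom ρ v))
  let Ψ : (X → K) × K × K →ₗ[K] K × K := (π₀.prod S) ∘ₗ LinearMap.fst K _ _
  have h1 : LinearMap.ker Φ ≤ LinearMap.range (principal ρ) := by
    intro p hp
    have hp' : (Dr p, π₀ (crossedHom ρ u p), π₀ (crossedHom ρ v p)) = 0 := hp
    simp only [Prod.mk_eq_zero] at hp'
    exact h p hp'.1 hp'.2.1 hp'.2.2
  have h2 := Submodule.finrank_mono h1
  have h3 := LinearMap.finrank_range_add_finrank_ker Φ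
  have h4 : LinearMap.range Φ ≤ LinearMap.ker Ψ := by
    rintro _ ⟨p, rfl⟩
    change (Dr p x₀, S (Dr p)) = 0
    rw [Prod.mk_eq_zero]
    refine ⟨crossedHom_commutator_apply_fixed σ κ hκ1 hκ hr hu hv (hone _ _) (hone _ _) p, ?_⟩
    rw [hDr, crossedHom_commutator _ hr, map_sub, map_add, map_add, hSρ, hSρ]
    ring
  have h5 := Submodule.finrank_mono h4
  have h6 := LinearMap.finrank_range_add_finrank_ker Ψ
  -- Evaluation at `x₀` and total sum are independent because `X` has a second point `x₁`.
  have hsurj : Function.Surjective Ψ := by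
    rintro ⟨a, b⟩
    refine ⟨(Pi.single x₀ a + Pi.single x₁ (b - a), 0, 0), ?_⟩
    change ((Pi.single x₀ a + Pi.single x₁ (b - a) : X → K) x₀,
      S (Pi.single x₀ a + Pi.single x₁ (b - a))) = (a, b)
    rw [hS]
    simp [Finset.sum_add_distrib, Pi.single_eq_of_ne hx.symm]
  rw [LinearMap.range_eq_top.2 hsurj, finrank_top] at h6
  have h7 := LinearMap.finrank_range_add_finrank_ker (principal ρ)
  have h8 : 0 < Module.finrank K (LinearMap.ker (principal ρ)) := by
    have : (fun _ => 1 : X → K) ∈ LinearMap.ker (principal ρ) := by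
      rw [LinearMap.mem_ker]
      change (ρ (of 0) _ - _, ρ (of 1) _ - _) = 0
      rw [Prod.mk_eq_zero]
      constructor <;> ext x <;> simp [ρ, twistedRep_apply, hone]
    rw [Module.finrank_pos_iff]
    exact ⟨⟨⟨_, this⟩, 0, fun h => one_ne_zero (congrFun (congrArg Subtype.val h) x₀)⟩⟩
  simp only [Module.finrank_prod, Module.finrank_self] at h3 h6
  omega

/-- A crossed homomorphism which is principal on the stabilizer of a point of a transitive action is
principal. -/
theorem exists_principal_of_stabilizer {x₀ : X} (htrans : ∀ x, ∃ g, σ g x₀ = x)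
    (hκ : ∀ g h x, κ (g * h) x = κ g x * κ h ((σ g)⁻¹ x)) {d : FreeGroup (Fin 2) → X → K}
    (hd : ∀ g h x, d (g * h) x = d g x + κ g x * d h ((σ g)⁻¹ x)) {θ : K}
    (hθ : ∀ s, σ s x₀ = x₀ → d s x₀ = κ s x₀ * θ - θ) :
    ∃ f : X → K, ∀ w x, d w x = κ w x * f ((σ w)⁻¹ x) - f x := by
  choose q hq using htrans
  have key : ∀ g g' x, σ g x₀ = x → σ g' x₀ = x →
      κ g x * θ - d g x = κ g' x * θ - d g' x := by
    intro g g' x hg hg'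
    have hs : σ (g⁻¹ * g') x₀ = x₀ := by
      rw [_root_.map_mul, Equiv.Perm.mul_apply, hg', _root_.map_inv, Equiv.Perm.inv_eq_iff_eq, hg]
    have h1 := hθ _ hs
    have hgx : (σ g)⁻¹ x = x₀ := by rw [Equiv.Perm.inv_eq_iff_eq, hg]
    have h2 := hd g (g⁻¹ * g') x
    have h3 := hκ g (g⁻¹ * g') x
    rw [mul_inv_cancel_left, hgx] at h2 h3
    rw [h2, h3, h1]
    ring
  -- The value at `x` is transported from `θ` at `x₀`. By `key` it does not depend on the element
  -- carrying `x₀` to `x`.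
  refine ⟨fun x => κ (q x) x * θ - d (q x) x, fun w x => ?_⟩
  have h1 := key (q x) (w * q ((σ w)⁻¹ x)) x (hq x) (by
    rw [_root_.map_mul, Equiv.Perm.mul_apply, hq]
    simp)
  simp only
  rw [h1, hκ, hd]
  ring

end Dimension

section Integral

variable {X R K : Type*} [Finite X] [CommRing R] [IsDomain R] [Field K] [Algebra R K]
  [IsFractionRing R K] (σ : FreeGroup (Fin 2) →* Equiv.Perm X) (κ : FreeGroup (Fin 2) → X → R)
  (hκ1 : ∀ x, algebraMap R K (κ 1 x) = 1)
  (hκ : ∀ g h x, algebraMap R K (κ (g * h) x) =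
    algebraMap R K (κ g x) * algebraMap R K (κ h ((σ g)⁻¹ x)))

/-- A crossed homomorphism over a fraction field becomes integral after clearing denominators. -/
theorem exists_integral_crossedHom {p : (X → K) × (X → K)}
    (hp : p ∉ LinearMap.range
      (principal (twistedRep σ (fun g x => algebraMap R K (κ g x)) hκ1 hκ))) :
    ∃ (b : R) (d : FreeGroup (Fin 2) → X → R),
      (∀ w x, algebraMap R K (d w x) = algebraMap R K b *
        crossedHom (twistedRep σ (fun g x => algebraMap R K (κ g x)) hκ1 hκ) w p x) ∧
      (∀ g h x, d (g * h) x = d g x + κ g x * d h ((σ g)⁻¹ x)) ∧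
      ¬ ∃ f : X → K, ∀ w x, algebraMap R K (d w x) =
        algebraMap R K (κ w x) * f ((σ w)⁻¹ x) - f x := by
  set ρ := twistedRep σ (fun g x => algebraMap R K (κ g x)) hκ1 hκ with hρ
  have hρa : ∀ g f x, ρ g f x = algebraMap R K (κ g x) * f ((σ g)⁻¹ x) := fun _ _ _ => rfl
  have hinj := IsFractionRing.injective R K
  obtain ⟨b, hb⟩ := IsLocalization.exist_integer_multiples_of_finite (nonZeroDivisors R)
    (Sum.elim p.1 p.2)
  have hb0 : algebraMap R K b ≠ 0 :=
    (map_ne_zero_iff _ hinj).2 (nonZeroDivisors.ne_zero b.2)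
  have hval : ∀ w x, ∃ a : R, algebraMap R K a = algebraMap R K b * crossedHom ρ w p x := by
    intro w
    induction w using FreeGroup.induction_on with
    | C1 => intro x; exact ⟨0, by rw [crossedHom_one]; simp⟩
    | of i =>
      intro x
      fin_cases i
      · obtain ⟨a, ha⟩ := hb (Sum.inl x)
        refine ⟨a, ?_⟩
        rw [ha]
        change (b : R) • p.1 x = _ * crossedHom ρ (of 0) p x
        rw [crossedHom_of_zero, Algebra.smul_def]
      · obtain ⟨a, ha⟩ := hb (Sum.inr x)
        refine ⟨a, ?_⟩
        rw [ha]
        change (b : R) • p.2 x = _ * crossedHom ρ (of 1) p x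
        rw [crossedHom_of_one, Algebra.smul_def]
    | inv_of i h =>
      intro x
      obtain ⟨a, ha⟩ := h ((σ (of i)⁻¹)⁻¹ x)
      refine ⟨-(κ (of i)⁻¹ x * a), ?_⟩
      rw [crossedHom_inv, Pi.neg_apply, hρa, map_neg, _root_.map_mul, ha]
      ring
    | mul g h hg hh =>
      intro x
      obtain ⟨a, ha⟩ := hg x
      obtain ⟨c, hc⟩ := hh ((σ g)⁻¹ x)
      refine ⟨a + κ g x * c, ?_⟩
      rw [crossedHom_mul, Pi.add_apply, hρa, map_add, _root_.map_mul, ha, hc]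
      ring
  choose d hd using hval
  refine ⟨b, d, hd, fun g h x => hinj ?_, ?_⟩
  · rw [map_add, _root_.map_mul, hd, hd, hd, crossedHom_mul, Pi.add_apply, hρa]
    ring
  · rintro ⟨f, hf⟩
    refine hp ⟨(algebraMap R K b)⁻¹ • f, ?_⟩
    have h1 : ∀ w, crossedHom ρ w p = ρ w ((algebraMap R K b)⁻¹ • f) -
        (algebraMap R K b)⁻¹ • f := by
      intro w
      ext x
      have h2 := hf w x
      rw [hd] at h2
      rw [Pi.sub_apply, hρa, Pi.smul_apply, Pi.smul_apply, smul_eq_mul, smul_eq_mul,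
        eq_comm, ← mul_right_inj' hb0, h2]
      field_simp
    refine Prod.ext ?_ ?_
    · rw [← crossedHom_of_zero ρ p, h1]; rfl
    · rw [← crossedHom_of_one ρ p, h1]; rfl

end Integral

/-! ### The integral and the twisted cocycle -/

section Cocycles

variable {X : Type*} [Finite X] {σ : FreeGroup (Fin 2) →* Equiv.Perm X}
  {u v : FreeGroup (Fin 2)} {x₀ : X}

theorem exists_additive_cocycle {x₁ : X} (hx : x₁ ≠ x₀) (htrans : ∀ x, ∃ g, σ g x₀ = x)
    (hu : σ u x₀ = x₀) (hv : σ v x₀ = x₀) (hr : σ (u * v * u⁻¹ * v⁻¹) = 1) :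
    ∃ k : FreeGroup (Fin 2) → X → ℤ, (∀ g h x, k (g * h) x = k g x + k h ((σ g)⁻¹ x)) ∧
      (∀ x, k (u * v * u⁻¹ * v⁻¹) x = 0) ∧ k u x₀ = 0 ∧ k v x₀ = 0 ∧
      ∃ s, σ s x₀ = x₀ ∧ k s x₀ ≠ 0 := by
  have := Fintype.ofFinite X
  let κ : FreeGroup (Fin 2) → X → ℤ := fun _ _ => 1
  have hκ1 : ∀ x, algebraMap ℤ ℚ (κ 1 x) = 1 := by simp [κ]
  have hκ : ∀ g h x, algebraMap ℤ ℚ (κ (g * h) x) =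
    algebraMap ℤ ℚ (κ g x) * algebraMap ℤ ℚ (κ h ((σ g)⁻¹ x)) := by simp [κ]
  have hone : ∀ g x, algebraMap ℤ ℚ (κ g x) = 1 := by simp [κ]
  obtain ⟨p, hp0, hpu, hpv, hp⟩ := exists_crossedHom_not_principal_of_trivial σ
    (fun g x => algebraMap ℤ ℚ (κ g x)) hκ1 hκ hx hone
    (twistedRep_eq_one σ _ hκ1 hκ hr fun x => hone (u * v * u⁻¹ * v⁻¹) x) hu hv
  obtain ⟨b, d, hd, hdmul, hdnp⟩ := exists_integral_crossedHom σ κ hκ1 hκ hp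
  have hinj := IsFractionRing.injective ℤ ℚ
  refine ⟨d, fun g h x => by rw [hdmul, one_mul], fun x => hinj ?_, hinj ?_, hinj ?_, ?_⟩
  · rw [hd, hp0]; simp
  · rw [hd, hpu]; simp
  · rw [hd, hpv]; simp
  -- A cocycle vanishing at `x₀` on the whole stabilizer would be principal, with `θ = 0`.
  · by_contra! h
    refine hdnp (exists_principal_of_stabilizer σ (fun g x => algebraMap ℤ ℚ (κ g x)) htrans hκ
      (d := fun g x => algebraMap ℤ ℚ (d g x)) (θ := 0) (fun g h x => ?_) fun s hs => ?_)
    · rw [hdmul, map_add, _root_.map_mul]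
    · rw [h s hs]; simp

theorem exists_twisted_cocycle (htrans : ∀ x, ∃ g, σ g x₀ = x)
    (hu : σ u x₀ = x₀) (hv : σ v x₀ = x₀) (hr : σ (u * v * u⁻¹ * v⁻¹) = 1)
    {k : FreeGroup (Fin 2) → X → ℤ} (hk : ∀ g h x, k (g * h) x = k g x + k h ((σ g)⁻¹ x))
    (hkr : ∀ x, k (u * v * u⁻¹ * v⁻¹) x = 0) (hku : k u x₀ = 0) (hkv : k v x₀ = 0)
    (hks : ∃ s, σ s x₀ = x₀ ∧ k s x₀ ≠ 0) :
    ∃ d : FreeGroup (Fin 2) → X → ℤ[T;T⁻¹],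
      (∀ g h x, d (g * h) x = d g x + T (k g x) * d h ((σ g)⁻¹ x)) ∧
      (∀ x, d (u * v * u⁻¹ * v⁻¹) x = 0) ∧ ∃ s, σ s x₀ = x₀ ∧ k s x₀ = 0 ∧ d s x₀ ≠ 0 := by
  have := Fintype.ofFinite X
  let K := FractionRing ℤ[T;T⁻¹]
  have hinj := IsFractionRing.injective ℤ[T;T⁻¹] K
  let κ : FreeGroup (Fin 2) → X → ℤ[T;T⁻¹] := fun g x => T (k g x)
  have hk1 : ∀ x, k 1 x = 0 := fun x => by
    have := hk 1 1 x
    rw [mul_one, _root_.map_one, inv_one, Equiv.Perm.one_apply] at this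
    omega
  have hκ1 : ∀ x, algebraMap ℤ[T;T⁻¹] K (κ 1 x) = 1 := fun x => by
    simp only [κ, hk1, T_zero, _root_.map_one]
  have hκ : ∀ g h x, algebraMap ℤ[T;T⁻¹] K (κ (g * h) x) =
      algebraMap ℤ[T;T⁻¹] K (κ g x) * algebraMap ℤ[T;T⁻¹] K (κ h ((σ g)⁻¹ x)) := fun g h x => by
    simp only [κ, hk, T_add, _root_.map_mul]
  have hκ0 : ∀ {g x}, k g x = 0 → algebraMap ℤ[T;T⁻¹] K (κ g x) = 1 := fun {g x} h => by
    simp only [κ, h, T_zero, _root_.map_one]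
  obtain ⟨p, hp0, hp⟩ := exists_crossedHom_not_principal σ
    (fun g x => algebraMap ℤ[T;T⁻¹] K (κ g x)) hκ1 hκ
    (twistedRep_eq_one σ _ hκ1 hκ hr fun x => hκ0 (hkr x)) hu hv (hκ0 hku) (hκ0 hkv)
  obtain ⟨b, d, hd, hdmul, hdnp⟩ := exists_integral_crossedHom σ κ hκ1 hκ hp
  refine ⟨d, hdmul, fun x => hinj ?_, ?_⟩
  · rw [hd, hp0]; simp
  by_contra! h
  obtain ⟨s₂, hs₂, hks₂⟩ := hks
  have hfix : ∀ s, σ s x₀ = x₀ → (σ s)⁻¹ x₀ = x₀ := fun s hs => by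
    rw [Equiv.Perm.inv_eq_iff_eq, hs]
  have hkinv : ∀ s, σ s x₀ = x₀ → k s⁻¹ x₀ = -k s x₀ := fun s hs => by
    have := hk s s⁻¹ x₀
    rw [mul_inv_cancel, hk1, hfix s hs] at this
    omega
  have hT1 : (1 - T (k s₂ x₀) : ℤ[T;T⁻¹]) ≠ 0 := fun h3 => by
    have := congrArg (fun f : ℤ[T;T⁻¹] => f.coeff 0) h3
    rw [← T_zero] at this
    simp [hks₂] at this
  -- Under the negated conclusion `d` vanishes at `x₀` on the commutator of `s` and `s₂`. Comparing
  -- `d (s * s₂)` with `d (s₂ * s)` makes `d` proportional to `1 - T ^ k` on the stabilizer, hence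
  -- principal after dividing by `1 - T (k s₂ x₀)`.
  have hcomm : ∀ s, σ s x₀ = x₀ →
      d s x₀ * (1 - T (k s₂ x₀)) = d s₂ x₀ * (1 - T (k s x₀)) := by
    intro s hs
    have hss : σ (s * s₂) x₀ = x₀ := by rw [_root_.map_mul, Equiv.Perm.mul_apply, hs₂, hs]
    have hss' : σ (s₂ * s) x₀ = x₀ := by rw [_root_.map_mul, Equiv.Perm.mul_apply, hs, hs₂]
    have hc : σ (s * s₂ * (s₂ * s)⁻¹) x₀ = x₀ := by
      rw [_root_.map_mul, Equiv.Perm.mul_apply, _root_.map_inv, hfix _ hss', hss]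
    have hkc : k (s * s₂ * (s₂ * s)⁻¹) x₀ = 0 := by
      rw [hk, hfix _ hss, hkinv _ hss', hk, hk, hfix _ hs, hfix _ hs₂]
      ring
    have h1 := hdmul (s * s₂ * (s₂ * s)⁻¹) (s₂ * s) x₀
    rw [inv_mul_cancel_right, hfix _ hc, h _ hc hkc, hdmul, hdmul, hfix _ hs, hfix _ hs₂] at h1
    simp only [κ, hkc, T_zero] at h1
    linear_combination h1
  have hT1' : algebraMap ℤ[T;T⁻¹] K (1 - T (k s₂ x₀)) ≠ 0 := (map_ne_zero_iff _ hinj).2 hT1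
  refine hdnp (exists_principal_of_stabilizer σ (fun g x => algebraMap ℤ[T;T⁻¹] K (κ g x)) htrans hκ
    (d := fun g x => algebraMap ℤ[T;T⁻¹] K (d g x))
    (θ := -(algebraMap ℤ[T;T⁻¹] K (d s₂ x₀) / algebraMap ℤ[T;T⁻¹] K (1 - T (k s₂ x₀))))
    (fun g h x => ?_) fun s hs => ?_)
  · rw [hdmul, map_add, _root_.map_mul]
  · have h1 := congrArg (algebraMap ℤ[T;T⁻¹] K) (hcomm s hs)
    rw [_root_.map_mul, _root_.map_mul] at h1
    rw [eq_div_of_mul_eq hT1' h1, map_sub, _root_.map_one]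
    ring

end Cocycles

/-- The image of `f` is free by Nielsen–Schreier, and a free group on at most one generator is
abelian. -/
theorem isLargeGroup_of_map_mul_ne {G : Type*} [Group G] [Group.FG G] {H : Subgroup G}
    [H.FiniteIndex] (f : H →* FreeGroup (Fin 2)) {x y : H} (h : f x * f y ≠ f y * f x) :
    IsLargeGroup G := by
  let e := IsFreeGroup.mulEquiv f.range
  refine ⟨inferInstance, H, inferInstance, IsFreeGroup.Generators f.range, ?_,
    e.symm.toMonoidHom.comp f.rangeRestrict, e.symm.surjective.comp f.rangeRestrict_surjective⟩
  by_contra hn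
  rw [not_nontrivial_iff_subsingleton] at hn
  have hcomm : ∀ z w : FreeGroup (IsFreeGroup.Generators f.range), z * w = w * z := by
    intro z w
    induction z using FreeGroup.induction_on with
    | C1 => simp
    | of i =>
      induction w using FreeGroup.induction_on with
      | C1 => simp
      | of j => rw [Subsingleton.elim i j]
      | inv_of j h => exact (Commute.inv_right (a := of i) h).eq
      | mul a b ha hb => exact (Commute.mul_right (a := of i) ha hb).eq
    | inv_of i h => exact (Commute.inv_left (b := w) h).eq
    | mul a b ha hb => exact (Commute.mul_left (c := w) ha hb).eq
  refine h ?_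
  have := hcomm (e.symm (f.rangeRestrict x)) (e.symm (f.rangeRestrict y))
  rw [← _root_.map_mul e.symm] at this
  exact congrArg Subtype.val (e.symm.injective (this.trans (_root_.map_mul e.symm _ _).symm))

/-! ### Permutational wreath products and largeness -/

section Permutational

variable {X L C : Type*} [Group L] [Group C]

/-- The homomorphism of permutational wreath products induced by a homomorphism of the base. -/
def mapPermWreath {M : Type*} [Group M] (f : L →* M) :
    (X → L) ⋊[mulAutArrow] Equiv.Perm X →* (X → M) ⋊[mulAutArrow] Equiv.Perm X :=
  SemidirectProduct.map (f.compLeft X) (MonoidHom.id _) fun _ => rfl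

/-- The kernel of the projection of the iterated wreath product onto its top part is a power of
the base, and this is the projection onto one of the factors. -/
def kerEval (x₀ : X) (j : C) :
    (mapPermWreath (X := X) (RegularWreathProduct.rightHom : L ≀ᵣ C →* C)).ker →* L where
  toFun p := (p.1.left x₀).left j
  map_one' := rfl
  map_mul' p q := by
    obtain ⟨p, hp⟩ := p
    obtain ⟨q, hq⟩ := q
    have h1 : p.right = 1 := congrArg SemidirectProduct.right hp
    have h2 : (p.left x₀).right = 1 := congrFun (congrArg SemidirectProduct.left hp) x₀
    change (p.left x₀ * q.left (p.right⁻¹ x₀)).left j = _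
    rw [h1, RegularWreathProduct.mul_left, h2]
    simp

end Permutational

section Large

variable {X : Type*} {σ : FreeGroup (Fin 2) →* Equiv.Perm X}
  {r : FreeGroup (Fin 2)} {x₀ : X}

/-- A crossed homomorphism with values in pairs of a Laurent polynomial and an integer is realised
by a homomorphism to a permutational wreath product. -/
theorem exists_permWreath_hom {k : FreeGroup (Fin 2) → X → ℤ}
    (hk : ∀ g h x, k (g * h) x = k g x + k h ((σ g)⁻¹ x))
    {d : FreeGroup (Fin 2) → X → ℤ[T;T⁻¹]}
    (hd : ∀ g h x, d (g * h) x = d g x + T (k g x) * d h ((σ g)⁻¹ x)) :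
    ∃ Λ : FreeGroup (Fin 2) →* (X → FreeGroup (Fin 2)) ⋊[mulAutArrow] Equiv.Perm X,
      ∀ g, (Λ g).right = σ g ∧ ∀ x, foxD ((Λ g).left x) = d g x ∧ texp ((Λ g).left x) = k g x := by
  -- The generators are free, so lifts of their cocycle values can be chosen arbitrarily. The
  -- cocycle identities then determine `foxD` and `texp` on all other elements.
  choose w hw using exists_foxD_eq
  let Λ : FreeGroup (Fin 2) →* (X → FreeGroup (Fin 2)) ⋊[mulAutArrow] Equiv.Perm X :=
    lift fun i => ⟨fun x => w (d (of i) x) (k (of i) x), σ (of i)⟩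
  have hΛ : ∀ g, (Λ g).right = σ g := fun g => by
    have : SemidirectProduct.rightHom.comp Λ = σ := by
      ext i : 1
      simp [Λ]
    exact DFunLike.congr_fun this g
  have hleft : ∀ g h x, (Λ (g * h)).left x = (Λ g).left x * (Λ h).left ((σ g)⁻¹ x) := by
    intro g h x
    rw [_root_.map_mul, ← hΛ]
    rfl
  have hk1 : ∀ x, k 1 x = 0 := fun x => by
    have := hk 1 1 x
    rw [mul_one, _root_.map_one, inv_one, Equiv.Perm.one_apply] at this
    omega
  have hd1 : ∀ x, d 1 x = 0 := fun x => by
    have := hd 1 1 x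
    rw [mul_one, _root_.map_one, inv_one, Equiv.Perm.one_apply, hk1, T_zero, one_mul] at this
    simpa using this
  refine ⟨Λ, fun g => ⟨hΛ g, ?_⟩⟩
  induction g using FreeGroup.induction_on with
  | C1 =>
    intro x
    rw [_root_.map_one, hd1, hk1]
    exact ⟨foxD_one, texp_one⟩
  | of i =>
    intro x
    have : (Λ (of i)).left x = w (d (of i) x) (k (of i) x) := by simp [Λ]
    rw [this]
    exact hw _ _
  | inv_of i h =>
    intro x
    obtain ⟨h1, h2⟩ := h ((σ (of i)) x)
    have hl := hleft (of i) (of i)⁻¹ (σ (of i) x)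
    have hk' := hk (of i) (of i)⁻¹ (σ (of i) x)
    have hd' := hd (of i) (of i)⁻¹ (σ (of i) x)
    rw [mul_inv_cancel, show (σ (of i))⁻¹ (σ (of i) x) = x from (σ (of i)).symm_apply_apply x] at hl hk' hd'
    rw [_root_.map_one, SemidirectProduct.one_left, Pi.one_apply] at hl
    have hft := congrArg foxD hl
    have htt := congrArg texp hl
    rw [foxD_one, foxD_mul, h1, h2] at hft
    rw [texp_one, texp_mul, h2] at htt
    rw [hk1] at hk'
    rw [hd1] at hd'
    refine ⟨?_, by omega⟩
    have h3 := add_left_cancel (hft.symm.trans hd')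
    exact (IsRegular.of_ne_zero (isUnit_T _).ne_zero).left h3
  | mul g h hg hh =>
    intro x
    rw [hleft, foxD_mul, texp_mul, (hg _).1, (hg _).2, (hh _).1, (hh _).2, hd, hk]
    exact ⟨rfl, rfl⟩

theorem crossed_pow_apply {k : FreeGroup (Fin 2) → X → ℤ}
    (hk : ∀ g h x, k (g * h) x = k g x + k h ((σ g)⁻¹ x)) {s : FreeGroup (Fin 2)}
    (hs : σ s x₀ = x₀) (n : ℕ) : k (s ^ (n + 1)) x₀ = (n + 1) * k s x₀ := by
  induction n with
  | zero => simp
  | succ n ih =>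
    rw [pow_succ', hk, Equiv.Perm.inv_eq_iff_eq.2 hs.symm, ih]
    push_cast
    ring

instance (rels : Set (FreeGroup (Fin 2))) : Group.FG (PresentedGroup rels) :=
  Group.fg_of_surjective (PresentedGroup.mk_surjective rels)

theorem isLargeGroup_of_cocycles [Finite X] {k : FreeGroup (Fin 2) → X → ℤ}
    (hk : ∀ g h x, k (g * h) x = k g x + k h ((σ g)⁻¹ x))
    {d : FreeGroup (Fin 2) → X → ℤ[T;T⁻¹]}
    (hd : ∀ g h x, d (g * h) x = d g x + T (k g x) * d h ((σ g)⁻¹ x))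
    (hr : σ r = 1) (hkr : ∀ x, k r x = 0) (hdr : ∀ x, d r x = 0)
    {s t : FreeGroup (Fin 2)} (hs : σ s x₀ = x₀) (hks : k s x₀ = 0) (hds : d s x₀ ≠ 0)
    (ht : σ t x₀ = x₀) (hkt : k t x₀ ≠ 0) : IsLargeGroup (PresentedGroup {r}) := by
  obtain ⟨Λ, hΛ⟩ := exists_permWreath_hom hk hd
  -- The coordinates of `Λ r` are trivial in `ℤ ≀ ℤ`. There are finitely many of them, so a single
  -- large `N` kills them all.
  have hev : ∀ᶠ N in Filter.atTop, ∀ x, cyclicWreath N ((Λ r).left x) = 1 :=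
    Filter.eventually_all.2 fun x => eventually_cyclicWreath_eq_one
      (by rw [((hΛ r).2 x).2, hkr]) (by rw [((hΛ r).2 x).1, hdr])
  obtain ⟨N, hN, hN0⟩ := (hev.and (Filter.eventually_ge_atTop 1)).exists
  have : NeZero N := ⟨by omega⟩
  let Φ := (mapPermWreath (X := X) (cyclicWreath N)).comp Λ
  have hΦ : ∀ g x, (Φ g).left x = cyclicWreath N ((Λ g).left x) := fun _ _ => rfl
  have hΦr : Φ r = 1 := by
    refine SemidirectProduct.ext (funext fun x => ?_) ?_
    · rw [hΦ, hN]; rfl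
    · change (Λ r).right = 1
      rw [(hΛ r).1, hr]
  let Ψ : PresentedGroup {r} →* _ := QuotientGroup.lift (Subgroup.normalClosure {r}) Φ
    fun g hg => map_eq_one_of_mem_normalClosure Φ hΦr hg
  let q := mapPermWreath (X := X)
    (RegularWreathProduct.rightHom : FreeGroup (Fin 2) ≀ᵣ Multiplicative (ZMod N) →* _)
  let H := (q.comp Ψ).ker
  have : Finite ((X → Multiplicative (ZMod N)) ⋊[mulAutArrow] Equiv.Perm X) :=
    Finite.of_equiv _ SemidirectProduct.equivProd.symm
  have hH : H.FiniteIndex := Subgroup.finiteIndex_ker _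
  -- Raising `s` and `t` to the index of the normal subgroup `H` puts them in `H`. It multiplies `d
  -- s x₀` and `k t x₀` by a nonzero integer, so both remain nonzero.
  obtain ⟨n, hn⟩ : ∃ n, H.index = n + 1 := Nat.exists_eq_succ_of_ne_zero hH.index_ne_zero
  have hmem : ∀ g, (g ^ (n + 1) : PresentedGroup {r}) ∈ H := fun g => by
    rw [← hn]; exact Subgroup.pow_index_mem H g
  have hnz : (n + 1 : ℤ) ≠ 0 := by omega
  have hks' : k (s ^ (n + 1)) x₀ = 0 := by rw [crossed_pow_apply hk hs, hks, mul_zero]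
  have hkt' : k (t ^ (n + 1)) x₀ ≠ 0 := by
    rw [crossed_pow_apply hk ht]; exact mul_ne_zero hnz hkt
  have hds' : d (s ^ (n + 1)) x₀ = (n + 1 : ℕ) • d s x₀ := by
    clear hn hmem hnz hks' hkt'
    induction n with
    | zero => simp
    | succ n ih =>
      rw [pow_succ', hd, hks, T_zero, one_mul, Equiv.Perm.inv_eq_iff_eq.2 hs.symm, ih,
        succ_nsmul' _ (n + 1)]
  have hds0 : d (s ^ (n + 1)) x₀ ≠ 0 := by
    rw [hds']; exact smul_ne_zero (by omega) hds
  obtain ⟨j, hj⟩ := exists_residuePart_ne_zero N hds0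
  let f : H →* FreeGroup (Fin 2) := (kerEval x₀ (Multiplicative.ofAdd j)).comp
    ((Ψ.comp H.subtype).codRestrict q.ker fun h => h.2)
  have hf : ∀ g (hg : (PresentedGroup.mk {r} g) ∈ H), f ⟨_, hg⟩ =
    (cyclicWreath N ((Λ g).left x₀)).left (Multiplicative.ofAdd j) := fun _ _ => rfl
  refine isLargeGroup_of_map_mul_ne f
    (x := ⟨PresentedGroup.mk {r} (s ^ (n + 1)), by rw [map_pow]; exact hmem _⟩)
    (y := ⟨PresentedGroup.mk {r} (t ^ (n + 1)), by rw [map_pow]; exact hmem _⟩) ?_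
  rw [hf, hf]
  have h1 := (cyclicWreath_spec N ((Λ (s ^ (n + 1))).left x₀)).2 j
  have h2 := (cyclicWreath_spec N ((Λ (t ^ (n + 1))).left x₀)).2 j
  rw [((hΛ _).2 _).1, ((hΛ _).2 _).2] at h1 h2
  -- In `ℤ ≀ ℤ` a nonzero base element does not commute with an element of nonzero `t`-exponent.
  refine mul_ne_mul_of_foxD ?_ ?_ ?_
  · rw [h1.1, hks']
  · rw [h1.2]; exact hj
  · rw [h2.1]; exact hkt'

theorem isLargeGroup_of_fixed [Finite X] {u v : FreeGroup (Fin 2)} {x₁ : X} (hx : x₁ ≠ x₀)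
    (htrans : ∀ x, ∃ g, σ g x₀ = x) (hu : σ u x₀ = x₀) (hv : σ v x₀ = x₀)
    (hr : σ (u * v * u⁻¹ * v⁻¹) = 1) : IsLargeGroup (PresentedGroup {u * v * u⁻¹ * v⁻¹}) := by
  obtain ⟨k, hk, hkr, hku, hkv, t, ht, hkt⟩ := exists_additive_cocycle hx htrans hu hv hr
  obtain ⟨d, hd, hdr, s, hs, hks, hds⟩ :=
    exists_twisted_cocycle htrans hu hv hr hk hkr hku hkv ⟨t, ht, hkt⟩
  exact isLargeGroup_of_cocycles hk hd hr hkr hdr hs hks hds ht hkt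

end Large

end FreeGroup

/-! ### The dichotomy on finite index subgroups containing `u` and `v` -/

namespace FreeGroup

section TwoGenerators

variable {u v : FreeGroup (Fin 2)}

theorem isLargeGroup_of_mem_subgroup {S : Subgroup (PresentedGroup {u * v * u⁻¹ * v⁻¹})}
    [S.FiniteIndex] (hS : S ≠ ⊤) (hu : PresentedGroup.mk _ u ∈ S)
    (hv : PresentedGroup.mk _ v ∈ S) : IsLargeGroup (PresentedGroup {u * v * u⁻¹ * v⁻¹}) := by
  let G := PresentedGroup {u * v * u⁻¹ * v⁻¹}
  let σ : FreeGroup (Fin 2) →* Equiv.Perm (G ⧸ S) :=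
    (MulAction.toPermHom G (G ⧸ S)).comp (PresentedGroup.mk _)
  have hσ : ∀ w, σ w ((1 : G) : G ⧸ S) = (PresentedGroup.mk _ w : G) := fun w => by
    change ((PresentedGroup.mk _ w * 1 : G) : G ⧸ S) = _
    rw [mul_one]
  have hfix : ∀ w, PresentedGroup.mk _ w ∈ S → σ w ((1 : G) : G ⧸ S) = ((1 : G) : G ⧸ S) :=
    fun w hw => by
      rw [hσ, eq_comm, QuotientGroup.eq]
      simpa using hw
  obtain ⟨g, hg⟩ : ∃ g, g ∉ S := by
    by_contra! h
    exact hS ((Subgroup.eq_top_iff' S).2 h)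
  refine isLargeGroup_of_fixed (σ := σ) (x₀ := ((1 : G) : G ⧸ S)) (x₁ := (g : G ⧸ S))
    (fun h => hg ?_) (fun x => ?_) (hfix u hu) (hfix v hv) ?_
  · rw [eq_comm, QuotientGroup.eq] at h
    simpa using h
  · obtain ⟨y, rfl⟩ := QuotientGroup.mk_surjective x
    obtain ⟨w, rfl⟩ := PresentedGroup.mk_surjective _ y
    exact ⟨w, hσ w⟩
  · have : PresentedGroup.mk {u * v * u⁻¹ * v⁻¹} (u * v * u⁻¹ * v⁻¹) = 1 :=
      PresentedGroup.one_of_mem (Set.mem_singleton _)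
    rw [MonoidHom.comp_apply, this, _root_.map_one]

/-- Modulo the normal core of `N` the commuting elements `x` and `y` generate, because the subgroup
they span together with the core has finite index and contains both. The quotient is therefore
abelian, as the centralizer arguments check. -/
theorem commutator_le_of_finiteIndex {G : Type*} [Group G] {x y : G} (hxy : Commute x y)
    (h : ∀ S : Subgroup G, S.FiniteIndex → x ∈ S → y ∈ S → S = ⊤) (N : Subgroup G)
    [N.FiniteIndex] : commutator G ≤ N := by
  refine le_trans ?_ N.normalCore_le
  let π := QuotientGroup.mk' N.normalCore
  have htop : Subgroup.closure {x, y} ⊔ N.normalCore = ⊤ :=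
    h _ (Subgroup.finiteIndex_of_le le_sup_right)
      (le_sup_left (b := N.normalCore) (Subgroup.subset_closure (by simp)))
      (le_sup_left (b := N.normalCore) (Subgroup.subset_closure (by simp)))
  have hall : ∀ K : Subgroup (G ⧸ N.normalCore), π x ∈ K → π y ∈ K → ∀ g, π g ∈ K := by
    intro K hx hy g
    have : Subgroup.closure {x, y} ⊔ N.normalCore ≤ K.comap π := by
      refine sup_le ((Subgroup.closure_le _).2 ?_) fun z hz => ?_
      · rintro z (rfl | rfl)
        exacts [hx, hy]
      · rw [Subgroup.mem_comap, show π z = 1 from (QuotientGroup.eq_one_iff z).2 hz]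
        exact K.one_mem
    exact this (htop ▸ Subgroup.mem_top g)
  have hxy' : Commute (π x) (π y) := hxy.map π
  have hx : ∀ g, Commute (π g) (π x) := fun g =>
    (Subgroup.mem_centralizer_singleton_iff.1 (hall (Subgroup.centralizer {π x})
      (Subgroup.mem_centralizer_singleton_iff.2 rfl)
      (Subgroup.mem_centralizer_singleton_iff.2 hxy'.symm.eq) g))
  have hy : ∀ g, Commute (π g) (π y) := fun g =>
    (Subgroup.mem_centralizer_singleton_iff.1 (hall (Subgroup.centralizer {π y})
      (Subgroup.mem_centralizer_singleton_iff.2 hxy'.eq)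
      (Subgroup.mem_centralizer_singleton_iff.2 rfl) g))
  rw [commutator_def, Subgroup.commutator_le]
  intro g _ k _
  refine (QuotientGroup.eq_one_iff _).1 ?_
  change π _ = 1
  rw [map_commutatorElement, commutatorElement_eq_one_iff_commute]
  exact Subgroup.mem_centralizer_singleton_iff.1 (hall (Subgroup.centralizer {π k})
    (Subgroup.mem_centralizer_singleton_iff.2 (hx k).symm.eq)
    (Subgroup.mem_centralizer_singleton_iff.2 (hy k).symm.eq) g)

theorem map_eq_exponentSum {A : Type*} [CommGroup A] (φ : FreeGroup (Fin 2) →* A)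
    (w : FreeGroup (Fin 2)) :
    φ w = φ (of 0) ^ (exponentSum 0 w).toAdd * φ (of 1) ^ (exponentSum 1 w).toAdd := by
  let ψ : FreeGroup (Fin 2) →* A :=
    ((zpowersHom A (φ (of 0))).comp (exponentSum 0)) * ((zpowersHom A (φ (of 1))).comp (exponentSum 1))
  have h : φ = ψ := by
    ext i
    fin_cases i <;> simp [ψ, exponentSum]
  exact DFunLike.congr_fun h w

theorem exponentSum_commutator (i : Fin 2) : exponentSum i (u * v * u⁻¹ * v⁻¹) = 1 := by
  rw [_root_.map_mul, _root_.map_mul, _root_.map_mul, _root_.map_inv, _root_.map_inv,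
    mul_right_comm, mul_inv_cancel_right, mul_inv_cancel]

theorem iInf_finiteIndex_le_commutator :
    ⨅ F ∈ {F : Subgroup (PresentedGroup {u * v * u⁻¹ * v⁻¹}) | F.FiniteIndex}, F ≤
      commutator (PresentedGroup {u * v * u⁻¹ * v⁻¹}) := by
  intro g hg
  obtain ⟨w, rfl⟩ := PresentedGroup.mk_surjective _ g
  rw [← Abelianization.ker_of, MonoidHom.mem_ker]
  have hsum : ∀ i, (exponentSum i w).toAdd = 0 := by
    intro i
    by_contra hne
    -- A modulus larger than the absolute value of the nonzero exponent sum, which is therefore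
    -- detected in a finite cyclic quotient.
    let N := (exponentSum i w).toAdd.natAbs + 1
    let ρ : FreeGroup (Fin 2) →* Multiplicative (ZMod N) :=
      (AddMonoidHom.toMultiplicative (Int.castAddHom (ZMod N))).comp (exponentSum i)
    let ψ : PresentedGroup {u * v * u⁻¹ * v⁻¹} →* Multiplicative (ZMod N) :=
      QuotientGroup.lift _ ρ fun z hz => map_eq_one_of_mem_normalClosure ρ
        (by rw [MonoidHom.comp_apply, exponentSum_commutator, _root_.map_one]) hz
    have hfin : ψ.ker.FiniteIndex := Subgroup.finiteIndex_ker _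
    have hmem : ψ (PresentedGroup.mk _ w) = 1 :=
      (Subgroup.mem_iInf.1 (Subgroup.mem_iInf.1 hg ψ.ker) hfin)
    have h0 : (((exponentSum i w).toAdd : ℤ) : ZMod N) = 0 := hmem
    rw [ZMod.intCast_zmod_eq_zero_iff_dvd] at h0
    have := Nat.le_of_dvd (Int.natAbs_pos.2 hne) (Int.natCast_dvd.1 h0)
    omega
  rw [← MonoidHom.comp_apply, map_eq_exponentSum, hsum, hsum, zpow_zero, zpow_zero, mul_one]

theorem isConj_commutator_of_commute
    (h : Commute (PresentedGroup.mk {u * v * u⁻¹ * v⁻¹} (of 0)) (PresentedGroup.mk _ (of 1))) :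
    IsConj (u * v * u⁻¹ * v⁻¹) (of 0 * of 1 * (of 0)⁻¹ * (of 1)⁻¹) ∨
      IsConj (u * v * u⁻¹ * v⁻¹) (of 1 * of 0 * (of 1)⁻¹ * (of 0)⁻¹) := by
  refine isConj_commutator_of_mem_normalClosure (exponentSum_commutator 0)
    (exponentSum_commutator 1) ((QuotientGroup.eq_one_iff _).1 ?_)
  change PresentedGroup.mk _ _ = 1
  rw [_root_.map_mul, _root_.map_mul, _root_.map_mul, h.eq, _root_.map_inv, _root_.map_inv,
    mul_inv_cancel_right, mul_inv_cancel]

theorem cyclicReduction_commutator_of {α : Type*} [DecidableEq α] {i j : α} (h : i ≠ j) :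
    cyclicReduction (of i * of j * (of i)⁻¹ * (of j)⁻¹) =
      (of i * of j * (of i)⁻¹ * (of j)⁻¹).toWord := by
  let L := [(i, true), (j, true), (i, false), (j, false)]
  have hL : IsCyclicallyReduced L := by
    simp [L, IsCyclicallyReduced, IsReduced, h, h.symm]
  change cyclicReduction (mk L) = (mk L).toWord
  rw [cyclicReduction_eq_of_isCyclicallyReduced hL, toWord_mk, hL.isReduced.reduce_eq]

end TwoGenerators

end FreeGroup

theorem corollary5p7 (a b : FreeGroup (Fin 2))
    (ha : a = FreeGroup.of 0) (hb : b = FreeGroup.of 1)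
    (u v : FreeGroup (Fin 2))
    (h₁ : ¬ (cyclicReduction (u * v * u⁻¹ * v⁻¹)).IsRotated (a * b * a⁻¹ * b⁻¹).toWord)
    (h₂ : ¬ (cyclicReduction (u * v * u⁻¹ * v⁻¹)).IsRotated (b * a * b⁻¹ * a⁻¹).toWord) :
    IsLargeGroup (PresentedGroup {u * v * u⁻¹ * v⁻¹}) ∨
      IsResiduallyUseless (PresentedGroup {u * v * u⁻¹ * v⁻¹}) := by
  subst ha hb
  -- When `G` is not large, no proper finite index subgroup contains both `u` and `v`.
  refine or_iff_not_imp_left.2 fun hL => ⟨inferInstance, fun hcomm => ?_, le_antisymm ?_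
    FreeGroup.iInf_finiteIndex_le_commutator⟩
  · rcases FreeGroup.isConj_commutator_of_commute (hcomm _ _) with h | h
    · exact h₁ (FreeGroup.cyclicReduction_commutator_of (i := (0 : Fin 2)) (j := 1) (by decide) ▸
        FreeGroup.isRotated_cyclicReduction_of_isConj h)
    · exact h₂ (FreeGroup.cyclicReduction_commutator_of (i := (1 : Fin 2)) (j := 0) (by decide) ▸
        FreeGroup.isRotated_cyclicReduction_of_isConj h)
  · refine le_iInf₂ fun N hN => ?_
    have : N.FiniteIndex := hN
    refine FreeGroup.commutator_le_of_finiteIndex (x := PresentedGroup.mk _ u)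
      (y := PresentedGroup.mk _ v) ?_ (fun S hS hu hv => ?_) N
    · rw [← commutatorElement_eq_one_iff_commute, ← map_commutatorElement]
      exact PresentedGroup.one_of_mem (Set.mem_singleton _)
    · by_contra hne
      exact hL (FreeGroup.isLargeGroup_of_mem_subgroup hne hu hv)
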